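/- All graphs are finite and simple. For a graph $G$ with degrees $d_G(\cdot)$, the sum-connectivity index is $$\chi(G)=\sum_{uv\in E(G)}\frac{1}{\sqrt{d_G(u)+d_G(v)}}.$$ A connected graph with $n$ vertices is bicyclic if it has exactly $n+1$ edges; let $\mathbb{B}(n)$ be the set of bicyclic graphs on $n$ vertices. Let $D$ be the unique bicyclic graph on four vertices, that is, $K_4$ minus an edge. For $a\ge b\ge 3$ with $a+b=n+2$, let $B_n(a,b)$ be the graph obtained from $D$ by attaching $a-3$ pendent vertices to one of its two vertices of degree three and $b-3$ pendent vertices to the other. For $n\ge 6$, let $B_{n,3}$ be the graph obtained from two triangles sharing exactly one vertex by attaching $n-5$ pendent vertices to the shared vertex. **Theorem.** Let $n\ge 5$. Up to isomorphism: 1. $B_n(n-1,3)$ is the unique graph with the minimum sum-connectivity index among the graphs in $\mathbb{B}(n)$, and this minimum is $$\frac{1}{\sqrt{n+2}}+\frac{n-4}{\sqrt{n}}+\frac{2}{\sqrt{n+1}}+\frac{2}{\sqrt5}.$$ 2. The second minimum, i.e. the smallest value of $\chi$ on $\mathbb{B}(n)$ that is larger than the minimum, is attained by exactly one graph in $\mathbb{B}(n)$,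 as follows. - If $n=5$, it is attained only by the graph obtained from $D$ by attaching a pendent vertex to a vertex of degree two, and is equal to $$\frac{3}{\sqrt6}+\frac{2}{\sqrt5}+\frac12.$$ - If $n=6$ or $n=7$, it is attained only by $B_n(n-2,4)$, and is equal to $$\frac{1}{\sqrt{n+2}}+\frac{2}{\sqrt{n}}+\frac{n-5}{\sqrt{n-1}}+\frac{2}{\sqrt6}+\frac{1}{\sqrt5}.$$ - If $n\ge 8$, it is attained only by $B_{n,3}$, and is equal to $$\frac{4}{\sqrt{n+1}}+\frac{n-5}{\sqrt{n}}+1.$$ -/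

import Mathlib

noncomputable section

namespace SumConn

open Classical in
/-- The sum-connectivity index: the sum over the edges `uv` of `1 / √(d(u) + d(v))`. -/
def sumConnectivity {V : Type*} [Fintype V] (G : SimpleGraph V) : ℝ :=
  ∑ e ∈ G.edgeFinset,
    Sym2.lift ⟨fun u v : V => 1 / √((G.degree u : ℝ) + (G.degree v : ℝ)),
      fun u v => by simp only [add_comm]⟩ e

open Classical in
/-- The bicyclic graphs with vertex set `V`: connected, with exactly `|V| + 1` edges. -/
def bicyclicGraphs (V : Type*) [Fintype V] : Set (SimpleGraph V) :=
  {G | G.Connected ∧ G.edgeFinset.card = Fintype.card V + 1}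

/-- The graph obtained from `H` by attaching, for every `p : P`, a new pendent vertex to the
vertex `f p` of `H`. -/
def attachPendents {W P : Type*} (H : SimpleGraph W) (f : P → W) : SimpleGraph (W ⊕ P) where
  Adj x y :=
    match x, y with
    | Sum.inl u, Sum.inl v => H.Adj u v
    | Sum.inl u, Sum.inr p => f p = u
    | Sum.inr p, Sum.inl u => f p = u
    | Sum.inr _, Sum.inr _ => False
  symm := ⟨by
    rintro (u | p) (v | q) h
    · exact H.adj_symm h
    · exact h
    · exact h
    · exact h⟩
  loopless := ⟨by
    rintro (u | p) h
    · exact H.loopless.irrefl u h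
    · exact h⟩

/-- The 4-vertex bicyclic graph, `K₄` minus the edge `{2, 3}`; the vertices of degree three are
`0` and `1`, those of degree two are `2` and `3`. -/
def diamond : SimpleGraph (Fin 4) :=
  SimpleGraph.fromEdgeSet {s(0, 1), s(0, 2), s(0, 3), s(1, 2), s(1, 3)}

/-- Two triangles sharing the vertex `0`. -/
def bowtie : SimpleGraph (Fin 5) :=
  SimpleGraph.fromEdgeSet {s(0, 1), s(0, 2), s(1, 2), s(0, 3), s(0, 4), s(3, 4)}

/-- `B_n(a, b)`, where `n = a + b - 2` and `a, b ≥ 3`: attach `a - 3` pendent vertices to one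
vertex of degree three of the diamond and `b - 3` to the other. -/
def graphB (a b : ℕ) : SimpleGraph (Fin 4 ⊕ (Fin (a - 3) ⊕ Fin (b - 3))) :=
  attachPendents diamond (Sum.elim (fun _ => 0) (fun _ => 1))

/-- `B_{n,3}`, where `n ≥ 5`: attach `n - 5` pendent vertices to the common vertex of the two
triangles of the bowtie. -/
def graphBThree (n : ℕ) : SimpleGraph (Fin 5 ⊕ Fin (n - 5)) :=
  attachPendents bowtie (fun _ => 0)

/-- The 5-vertex graph obtained by attaching a pendent vertex to a vertex of degree two of the
diamond. -/
def graphFive : SimpleGraph (Fin 4 ⊕ Fin 1) :=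
  attachPendents diamond (fun _ => 2)

/-- `c` is the minimum sum-connectivity index among the bicyclic graphs on `V`, and the graphs
attaining it are exactly those isomorphic to `B`. -/
def IsUniqueMinimum (V : Type*) [Fintype V] {W : Type*} (B : SimpleGraph W) (c : ℝ) : Prop :=
  IsLeast (sumConnectivity '' bicyclicGraphs V) c ∧
    ∀ G ∈ bicyclicGraphs V, sumConnectivity G = c ↔ Nonempty (G ≃g B)

/-- `c` is the second minimum sum-connectivity index among the bicyclic graphs on `V`, that is,
the least of the values that are not the minimum one, and the graphs attaining it are exactly
those isomorphic to `B`. -/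
def IsUniqueSecondMinimum (V : Type*) [Fintype V] {W : Type*} (B : SimpleGraph W) (c : ℝ) :
    Prop :=
  IsLeast {x ∈ sumConnectivity '' bicyclicGraphs V |
      ∃ y ∈ sumConnectivity '' bicyclicGraphs V, y < x} c ∧
    ∀ G ∈ bicyclicGraphs V, sumConnectivity G = c ↔ Nonempty (G ≃g B)

end SumConn

end

/-!
Replace each summand `1 / √k` by the tangent of the convex function `x ↦ 1 / √x` at a suitable
integer. Since the sum of `d(u) + d(v)` over the edges `uv` is the sum of the squared degrees, this
bounds `χ` from below by a decreasing function of the first Zagreb index, and the latter is bounded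
above by means of the extreme degrees. For `n ≤ 8` this is sharp enough.

For larger `n`, a bicyclic graph with a universal vertex is `B_n(n - 1, 3)` or `B_{n,3}`. Otherwise
induct on `n`. Without pendent vertices all degrees lie between 2 and 4, and the tangent at 4
already gives `χ ≥ n / 2`. Attaching a pendent vertex at a vertex of degree `d - 1` raises `χ` by at
least `d / √(d + 1) - (d - 1) / √d`, which decreases in `d`; in the absence of a universal vertex
this gain exceeds the increment of `χ(B_{n,3})`. If deleting the pendent vertex creates a universal
vertex, then either the pendent vertex was attached at a vertex of small degree, where its gain is
large, or the graph is `B_n(n - 2, 4)`.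
-/

noncomputable section

namespace SumConn

open scoped Classical
open SimpleGraph

section invSqrt

/-- The summand `1 / √k` contributed to the sum-connectivity index by an edge whose end vertices
have degree sum `k`. -/
def invSqrt (k : ℕ) : ℝ := 1 / √(k : ℝ)

/-- The decrease of `invSqrt` from `k` to `k + 1`. -/
def invSqrtGap (k : ℕ) : ℝ := invSqrt k - invSqrt (k + 1)

/-- The difference between the sum-connectivity indices of the stars with `d` and with `d - 1`
edges. -/
def starGain (d : ℕ) : ℝ := d * invSqrt (d + 1) - (d - 1) * invSqrt d

theorem invSqrt_pos {k : ℕ} (hk : 0 < k) : 0 < invSqrt k := by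
  unfold invSqrt
  positivity

theorem invSqrt_le_invSqrt {k l : ℕ} (hk : 0 < k) (hkl : k ≤ l) : invSqrt l ≤ invSqrt k := by
  unfold invSqrt
  gcongr

theorem invSqrt_sq_of_sq {r k : ℕ} (h : r ^ 2 = k) : invSqrt k = 1 / r := by
  rw [invSqrt, ← h, Nat.cast_pow, Real.sqrt_sq r.cast_nonneg]

theorem invSqrt_four : invSqrt 4 = 1 / 2 := by
  simpa using invSqrt_sq_of_sq (r := 2) rfl

theorem invSqrt_nine : invSqrt 9 = 1 / 3 := by
  simpa using invSqrt_sq_of_sq (r := 3) rfl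

/-- The left-hand side is the value at `x` of the tangent at `a` to the convex function
`x ↦ 1 / √x`. -/
theorem invSqrt_tangent_le {a x : ℕ} (ha : 0 < a) (hx : 0 < x) :
    invSqrt a * (3 * a - x) / (2 * a) ≤ invSqrt x := by
  unfold invSqrt
  have hs : 0 < √(a : ℝ) := by positivity
  have ht : 0 < √(x : ℝ) := by positivity
  have ha_sq : (a : ℝ) = √(a : ℝ) ^ 2 := by simp
  have hx_sq : (x : ℝ) = √(x : ℝ) ^ 2 := by simp
  set s := √(a : ℝ)
  set t := √(x : ℝ)
  rw [ha_sq, hx_sq]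
  have hcubic : 0 ≤ (t - s) ^ 2 * (t + 2 * s) := by positivity
  rw [one_div_mul_eq_div, div_div, div_le_div_iff₀ (by positivity) ht]
  nlinarith

theorem invSqrtGap_eq {m : ℕ} (hm : 0 < m) :
    invSqrtGap m = 1 / (√m * √(m + 1) * (√m + √(m + 1))) := by
  unfold invSqrtGap invSqrt
  push_cast
  have ha_sq : √(m : ℝ) ^ 2 = m := Real.sq_sqrt (by positivity)
  have hb_sq : √((m : ℝ) + 1) ^ 2 = m + 1 := Real.sq_sqrt (by positivity)
  field_simp
  linear_combination hb_sq - ha_sq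

theorem invSqrtGap_pos {m : ℕ} (hm : 0 < m) : 0 < invSqrtGap m := by
  rw [invSqrtGap_eq hm]
  positivity

theorem invSqrtGap_le_invSqrtGap {m k : ℕ} (hm : 0 < m) (hmk : m ≤ k) :
    invSqrtGap k ≤ invSqrtGap m := by
  rw [invSqrtGap_eq hm, invSqrtGap_eq (hm.trans_le hmk)]
  gcongr

/-- With `a, b, c = √m, √(m+1), √(m+2)`, this follows from `a c ≤ b²` and
`2 b c ≤ b² + c² = 2 m + 3`. -/
theorem two_mul_invSqrtGap_le {m : ℕ} (hm : 0 < m) :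
    2 * m * invSqrtGap m ≤ (2 * m + 3) * invSqrtGap (m + 1) := by
  rw [invSqrtGap_eq hm, invSqrtGap_eq m.succ_pos]
  push_cast
  rw [add_assoc, one_add_one_eq_two]
  have ha : 0 < √(m : ℝ) := by positivity
  have hb : 0 < √((m : ℝ) + 1) := by positivity
  have hc : 0 < √((m : ℝ) + 2) := by positivity
  have ha_sq : √(m : ℝ) ^ 2 = m := Real.sq_sqrt (by positivity)
  have hb_sq : √((m : ℝ) + 1) ^ 2 = m + 1 := Real.sq_sqrt (by positivity)
  have hc_sq : √((m : ℝ) + 2) ^ 2 = m + 2 := Real.sq_sqrt (by positivity)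
  set a := √(m : ℝ)
  set b := √((m : ℝ) + 1)
  set c := √((m : ℝ) + 2)
  have hac : a * c ≤ b ^ 2 := by nlinarith [sq_nonneg (a - c)]
  have hbc : 2 * (b * c) ≤ 2 * m + 3 := by nlinarith [sq_nonneg (b - c)]
  have habc : a * (b + c) ≤ b * (a + b) := by linarith
  rw [mul_one_div, mul_one_div, div_le_div_iff₀ (by positivity) (by positivity)]
  calc 2 * m * (b * c * (b + c)) = 2 * a * b * c * (a * (b + c)) := by rw [← ha_sq]; ring
    _ ≤ 2 * a * b * c * (b * (a + b)) := by gcongr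
    _ = 2 * (b * c) * (a * b * (a + b)) := by ring
    _ ≤ (2 * m + 3) * (a * b * (a + b)) := by gcongr

theorem starGain_eq_sub_mul_invSqrtGap (d : ℕ) :
    starGain d = invSqrt d - d * invSqrtGap d := by
  unfold starGain invSqrtGap
  ring

theorem starGain_sub_succ (d : ℕ) :
    starGain d - starGain (d + 1) = (d + 1) * invSqrtGap (d + 1) - (d - 1) * invSqrtGap d := by
  unfold starGain invSqrtGap
  push_cast
  ring

theorem starGain_antitoneOn : AntitoneOn starGain (Set.Ici 1) := by
  refine antitoneOn_nat_Ici_of_succ_le fun d hd => ?_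
  have hgap := invSqrtGap_pos hd
  have hratio := two_mul_invSqrtGap_le hd
  have hscaled : 0 ≤ (2 * (d : ℝ) + 3) * (starGain d - starGain (d + 1)) := by
    rw [starGain_sub_succ]
    linear_combination (d + 1 : ℝ) * hratio + (d + 3 : ℝ) * hgap
  exact sub_nonneg.1 (nonneg_of_mul_nonneg_right hscaled (by positivity))

theorem lt_invSqrt_and_invSqrt_lt {k : ℕ} {l u : ℝ} (hu : 0 < u) (hl : l ^ 2 * k < 1)
    (hu' : 1 < u ^ 2 * k) : l < invSqrt k ∧ invSqrt k < u := by
  have hk : (0 : ℝ) < k := by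
    by_contra! h
    nlinarith [sq_nonneg u]
  have hs : 0 < √(k : ℝ) := by positivity
  have hs_sq : √(k : ℝ) ^ 2 = k := Real.sq_sqrt hk.le
  unfold invSqrt
  rw [lt_div_iff₀ hs, div_lt_iff₀ hs]
  constructor
  · nlinarith
  · nlinarith [mul_pos hu hs]

theorem invSqrt_three_bounds : 0.577350 < invSqrt 3 ∧ invSqrt 3 < 0.577351 :=
  lt_invSqrt_and_invSqrt_lt (by norm_num) (by norm_num) (by norm_num)

theorem invSqrt_five_bounds : 0.447213 < invSqrt 5 ∧ invSqrt 5 < 0.447214 :=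
  lt_invSqrt_and_invSqrt_lt (by norm_num) (by norm_num) (by norm_num)

theorem invSqrt_six_bounds : 0.408248 < invSqrt 6 ∧ invSqrt 6 < 0.408249 :=
  lt_invSqrt_and_invSqrt_lt (by norm_num) (by norm_num) (by norm_num)

theorem invSqrt_seven_bounds : 0.377964 < invSqrt 7 ∧ invSqrt 7 < 0.377965 :=
  lt_invSqrt_and_invSqrt_lt (by norm_num) (by norm_num) (by norm_num)

theorem invSqrt_eight_bounds : 0.353553 < invSqrt 8 ∧ invSqrt 8 < 0.353554 :=
  lt_invSqrt_and_invSqrt_lt (by norm_num) (by norm_num) (by norm_num)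

theorem invSqrt_ten_bounds : 0.316227 < invSqrt 10 ∧ invSqrt 10 < 0.316228 :=
  lt_invSqrt_and_invSqrt_lt (by norm_num) (by norm_num) (by norm_num)

end invSqrt

section edgeSums

variable {V : Type*} [Fintype V]

/-- The map sending an unordered pair `uv` to `invSqrt (D u + D v)`. -/
def weight {V : Type*} (D : V → ℕ) : Sym2 V → ℝ :=
  Sym2.lift ⟨fun u v => invSqrt (D u + D v), fun u v => by simp only [add_comm]⟩

/-- The first Zagreb index: the sum of the squares of the vertex degrees. -/
def firstZagreb (G : SimpleGraph V) : ℕ := ∑ v, G.degree v ^ 2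

@[simp]
theorem weight_mk {V : Type*} (D : V → ℕ) (u v : V) :
    weight D s(u, v) = invSqrt (D u + D v) := rfl

theorem sumConnectivity_eq (G : SimpleGraph V) :
    sumConnectivity G = ∑ e ∈ G.edgeFinset, weight (fun v => G.degree v) e := by
  unfold sumConnectivity
  refine Finset.sum_congr rfl fun e _ => ?_
  induction e with
  | h u v => simp [invSqrt]

theorem sumConnectivity_congr {W : Type*} [Fintype W] {G : SimpleGraph V} {H : SimpleGraph W}
    (e : G ≃g H) : sumConnectivity G = sumConnectivity H := by
  rw [sumConnectivity_eq, sumConnectivity_eq]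
  refine Finset.sum_nbij' (Sym2.map e) (Sym2.map e.symm) ?_ ?_ ?_ ?_ ?_
  · rintro ⟨u, v⟩
    simpa using e.map_adj_iff.2
  · rintro ⟨u, v⟩
    simpa using e.symm.map_adj_iff.2
  · simp [Sym2.map_map]
  · simp [Sym2.map_map]
  · rintro ⟨u, v⟩ _
    simp [weight]

theorem sum_edgeFinset_ite_mem (G : SimpleGraph V) (v : V) (r : ℝ) :
    ∑ e ∈ G.edgeFinset, (if v ∈ e then r else 0) = G.degree v * r := by
  rw [← Finset.sum_filter, ← incidenceFinset_eq_filter, Finset.sum_const,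
    card_incidenceFinset_eq_degree, nsmul_eq_mul]

theorem sum_edgeFinset_sum_mem (G : SimpleGraph V) (h : V → ℝ) :
    ∑ e ∈ G.edgeFinset, ∑ v, (if v ∈ e then h v else 0) = ∑ v, G.degree v * h v := by
  rw [Finset.sum_comm]
  exact Finset.sum_congr rfl fun v _ => sum_edgeFinset_ite_mem G v (h v)

theorem sum_ite_mem_mk {u v : V} (huv : u ≠ v) (h : V → ℝ) :
    ∑ x, (if x ∈ s(u, v) then h x else 0) = h u + h v := by
  have hpair : Finset.univ.filter (· ∈ s(u, v)) = {u, v} := by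
    ext x
    simp
  rw [← Finset.sum_filter, hpair, Finset.sum_pair huv]

/-- The sum of `d(u) + d(v)` over the edges `uv` is the first Zagreb index, so this is the sum of
the tangent line bounds at `a`. -/
theorem zagreb_le_sumConnectivity (G : SimpleGraph V) {a : ℕ} (ha : 0 < a) :
    invSqrt a * (3 * a * G.edgeFinset.card - firstZagreb G) / (2 * a) ≤ sumConnectivity G := by
  rw [sumConnectivity_eq]
  calc invSqrt a * (3 * a * G.edgeFinset.card - firstZagreb G) / (2 * a)
      = ∑ e ∈ G.edgeFinset,
          invSqrt a * (3 * a - ∑ v, (if v ∈ e then (G.degree v : ℝ) else 0)) / (2 * a) := by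
        rw [← Finset.sum_div, ← Finset.mul_sum, Finset.sum_sub_distrib, sum_edgeFinset_sum_mem,
          firstZagreb]
        simp only [Finset.sum_const, nsmul_eq_mul, Nat.cast_sum, Nat.cast_mul, sq]
        ring
    _ ≤ ∑ e ∈ G.edgeFinset, weight (fun v => G.degree v) e := Finset.sum_le_sum fun e he => ?_
  induction e with
  | h u v =>
    have huv : G.Adj u v := by simpa using he
    have hdeg : 0 < G.degree u := (G.degree_pos_iff_exists_adj u).2 ⟨v, huv⟩
    rw [sum_ite_mem_mk huv.ne, weight_mk]
    exact_mod_cast invSqrt_tangent_le ha (Nat.add_pos_left hdeg (G.degree v))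

theorem sum_degree_le_card_biUnion_incidenceFinset_add_choose (G : SimpleGraph V)
    (S : Finset V) :
    ∑ v ∈ S, G.degree v ≤ (S.biUnion fun v => G.incidenceFinset v).card + S.card.choose 2 := by
  induction S using Finset.induction_on with
  | empty => simp
  | insert v S hv ih =>
    have hinter : (G.incidenceFinset v ∩ S.biUnion fun v => G.incidenceFinset v).card ≤ S.card := by
      refine (Finset.card_le_card fun e he => ?_).trans
        (Finset.card_image_le (s := S) (f := fun x => s(v, x)))
      simp only [Finset.mem_inter, Finset.mem_biUnion, mem_incidenceFinset] at he
      obtain ⟨hve, x, hx, hxe⟩ := he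
      have hvx : v ≠ x := fun h => hv (h ▸ hx)
      exact Finset.mem_image.2
        ⟨x, hx, (G.incidenceSet_inter_incidenceSet_subset hvx ⟨hve, hxe⟩).symm⟩
    have hunion := Finset.card_union_add_card_inter (G.incidenceFinset v)
      (S.biUnion fun v => G.incidenceFinset v)
    rw [card_incidenceFinset_eq_degree] at hunion
    rw [Finset.sum_insert hv, Finset.card_insert_of_notMem hv, Finset.biUnion_insert,
      Nat.choose_succ_succ' _ 1, Nat.choose_one_right, one_add_one_eq_two]
    omega

theorem sum_degree_le_card_edgeFinset_add_choose (G : SimpleGraph V) (S : Finset V) :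
    ∑ v ∈ S, G.degree v ≤ G.edgeFinset.card + S.card.choose 2 :=
  (sum_degree_le_card_biUnion_incidenceFinset_add_choose G S).trans <|
    Nat.add_le_add_right (Finset.card_le_card <|
      Finset.biUnion_subset.2 fun v _ => G.incidenceFinset_subset v) _

theorem even_firstZagreb (G : SimpleGraph V) : Even (firstZagreb G) := by
  have hsum : Even (firstZagreb G + 2 * G.edgeFinset.card) := by
    rw [← sum_degrees_eq_twice_card_edges, firstZagreb, ← Finset.sum_add_distrib]
    refine Finset.even_sum _ fun v _ => ?_
    rw [sq, ← Nat.mul_succ]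
    exact Nat.even_mul_succ_self _
  exact (Nat.even_add.1 hsum).2 (even_two_mul _)

/-- This is the sum of `(h - d(v)) * (d(v) - l) ≥ 0`, rearranged to avoid subtraction. -/
theorem sum_degree_sq_add_le (G : SimpleGraph V) {S : Finset V} {l h : ℕ}
    (hl : ∀ v ∈ S, l ≤ G.degree v) (hh : ∀ v ∈ S, G.degree v ≤ h) :
    ∑ v ∈ S, G.degree v ^ 2 + l * h * S.card ≤ (l + h) * ∑ v ∈ S, G.degree v := by
  rw [Finset.mul_sum, mul_comm _ S.card, ← smul_eq_mul S.card, ← Finset.sum_const,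
    ← Finset.sum_add_distrib]
  refine Finset.sum_le_sum fun v hv => ?_
  obtain ⟨i, hi⟩ := Nat.exists_eq_add_of_le (hl v hv)
  obtain ⟨j, hj⟩ := Nat.exists_eq_add_of_le (hh v hv)
  rw [hj, hi]
  nlinarith [Nat.zero_le (i * j)]

end edgeSums

section bicyclic

variable {V : Type*} [Fintype V]

theorem mem_bicyclicGraphs_congr {W : Type*} [Fintype W] {G : SimpleGraph V}
    {H : SimpleGraph W} (e : G ≃g H) (hG : G ∈ bicyclicGraphs V) : H ∈ bicyclicGraphs W := by
  refine ⟨e.connected_iff.1 hG.1, ?_⟩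
  rw [← Fintype.card_congr e.toEquiv, ← hG.2]
  exact e.card_edgeFinset_eq.symm

theorem sum_degree_of_mem_bicyclicGraphs {G : SimpleGraph V} (hG : G ∈ bicyclicGraphs V) :
    ∑ v, G.degree v = 2 * (Fintype.card V + 1) := by
  rw [sum_degrees_eq_twice_card_edges, ← hG.2]

theorem degree_pos_of_mem_bicyclicGraphs {G : SimpleGraph V} (hG : G ∈ bicyclicGraphs V) (v : V) :
    0 < G.degree v := by
  have : Nontrivial V := by
    rw [← Fintype.one_lt_card_iff_nontrivial]
    by_contra! hle
    have hedges := G.card_edgeFinset_le_card_choose_two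
    rw [hG.2, Nat.choose_eq_zero_of_lt (Nat.lt_succ_of_le hle)] at hedges
    omega
  exact hG.1.preconnected.degree_pos_of_nontrivial v

end bicyclic

section attachPendents

variable {W P : Type*} (H : SimpleGraph W) (f : P → W)

@[simp]
theorem attachPendents_adj_inl_inl (a b : W) :
    (attachPendents H f).Adj (Sum.inl a) (Sum.inl b) ↔ H.Adj a b := Iff.rfl

@[simp]
theorem attachPendents_adj_inl_inr (a : W) (p : P) :
    (attachPendents H f).Adj (Sum.inl a) (Sum.inr p) ↔ f p = a := Iff.rfl

@[simp]
theorem attachPendents_adj_inr_inl (a : W) (p : P) :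
    (attachPendents H f).Adj (Sum.inr p) (Sum.inl a) ↔ f p = a := Iff.rfl

@[simp]
theorem attachPendents_adj_inr_inr (p q : P) :
    ¬ (attachPendents H f).Adj (Sum.inr p) (Sum.inr q) := fun h => h

variable {H} in
theorem attachPendents_connected (hH : H.Connected) : (attachPendents H f).Connected := by
  have := hH.nonempty
  let φ : H →g attachPendents H f := ⟨Sum.inl, fun h => h⟩
  have hinl : ∀ x : W ⊕ P, ∃ a : W, (attachPendents H f).Reachable x (Sum.inl a) := by
    rintro (a | p)
    · exact ⟨a, Reachable.rfl⟩
    · exact ⟨f p, Adj.reachable (by simp)⟩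
  refine (connected_iff _).2 ⟨fun x y => ?_, inferInstance⟩
  obtain ⟨a, ha⟩ := hinl x
  obtain ⟨b, hb⟩ := hinl y
  exact ha.trans (((hH.preconnected a b).map φ).trans hb.symm)

variable {H} in
theorem attachPendents_isUniversal_inl {c : W} (hc : H.IsUniversal c) :
    (attachPendents H (fun _ : P => c)).IsUniversal (Sum.inl c) := by
  rintro (a | p) ha
  · exact hc fun h => ha (h ▸ rfl)
  · simp

variable [Fintype W] [Fintype P]

theorem attachPendents_degree_inl (a : W) :
    (attachPendents H f).degree (Sum.inl a)
      = H.degree a + (Finset.univ.filter fun p => f p = a).card := by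
  have hnbr : (attachPendents H f).neighborFinset (Sum.inl a)
      = (H.neighborFinset a).disjSum (Finset.univ.filter fun p => f p = a) := by
    ext x
    rcases x with b | p <;> simp
  rw [← card_neighborFinset_eq_degree, hnbr, Finset.card_disjSum, card_neighborFinset_eq_degree]

theorem attachPendents_degree_inr (p : P) :
    (attachPendents H f).degree (Sum.inr p) = 1 := by
  refine degree_eq_one_iff_existsUnique_adj.2 ⟨Sum.inl (f p), by simp, ?_⟩
  rintro (a | q) h
  · exact congrArg Sum.inl (Eq.symm h)
  · exact h.elim

theorem edgeFinset_attachPendents :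
    (attachPendents H f).edgeFinset
      = H.edgeFinset.image (Sym2.map Sum.inl)
        ∪ Finset.univ.image fun p : P => s(Sum.inl (f p), Sum.inr p) := by
  ext e
  simp only [mem_edgeFinset, Finset.mem_union, Finset.mem_image, Finset.mem_univ, true_and]
  constructor
  · rcases e with ⟨a | p, b | q⟩ <;> intro h
    · exact Or.inl ⟨s(a, b), h, rfl⟩
    · exact Or.inr ⟨q, congrArg (s(Sum.inl ·, Sum.inr q)) h⟩
    · exact Or.inr ⟨p, (congrArg (s(Sum.inl ·, Sum.inr p)) h).trans Sym2.eq_swap⟩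
    · exact h.elim
  · rintro (⟨⟨a, b⟩, hab, rfl⟩ | ⟨p, rfl⟩)
    · exact hab
    · simp

theorem sum_edgeFinset_attachPendents {M : Type*} [AddCommMonoid M] (φ : Sym2 (W ⊕ P) → M) :
    ∑ e ∈ (attachPendents H f).edgeFinset, φ e
      = ∑ e ∈ H.edgeFinset, φ (e.map Sum.inl) + ∑ p, φ s(Sum.inl (f p), Sum.inr p) := by
  rw [edgeFinset_attachPendents, Finset.sum_union, Finset.sum_image, Finset.sum_image]
  · intro p _ q _ h
    simpa using (show f p = f q ∧ p = q by simpa using h).2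
  · exact (Sym2.map.injective Sum.inl_injective).injOn
  · simp only [Finset.disjoint_left, Finset.mem_image, not_exists, not_and]
    rintro - ⟨⟨a, b⟩, -, rfl⟩ p - h
    simp at h

theorem card_edgeFinset_attachPendents :
    (attachPendents H f).edgeFinset.card = H.edgeFinset.card + Fintype.card P := by
  simpa using sum_edgeFinset_attachPendents H f fun _ => (1 : ℕ)

theorem sumConnectivity_attachPendents :
    sumConnectivity (attachPendents H f)
      = ∑ e ∈ H.edgeFinset,
          weight (fun a => H.degree a + (Finset.univ.filter fun p => f p = a).card) e
        + ∑ p, invSqrt (H.degree (f p) + (Finset.univ.filter fun q => f q = f p).card + 1) := by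
  rw [sumConnectivity_eq, sum_edgeFinset_attachPendents]
  congr 1
  · refine Finset.sum_congr rfl fun e _ => ?_
    induction e with
    | h a b => simp [attachPendents_degree_inl]
  · simp [attachPendents_degree_inl, attachPendents_degree_inr]

variable {H} in
theorem attachPendents_mem_bicyclicGraphs_iff (hconn : H.Connected) :
    attachPendents H f ∈ bicyclicGraphs (W ⊕ P) ↔ H ∈ bicyclicGraphs W := by
  simp only [bicyclicGraphs, Set.mem_ofPred_eq, hconn, attachPendents_connected f hconn, true_and,
    card_edgeFinset_attachPendents, Fintype.card_sum]
  omega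

variable {H} in
theorem attachPendents_mem_bicyclicGraphs (hH : H ∈ bicyclicGraphs W) :
    attachPendents H f ∈ bicyclicGraphs (W ⊕ P) :=
  (attachPendents_mem_bicyclicGraphs_iff f hH.1).2 hH

/-- Each edge at `v` loses at most `invSqrtGap (d(v) + 1)`, since its other end has positive
degree. -/
theorem sumConnectivity_add_starGain_le (v : W) :
    sumConnectivity H + starGain (H.degree v + 1)
      ≤ sumConnectivity (attachPendents H (fun _ : Unit => v)) := by
  have hedge : ∀ e ∈ H.edgeFinset, weight (fun a => H.degree a) e
      - (if v ∈ e then invSqrtGap (H.degree v + 1) else 0)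
        ≤ weight (fun a => H.degree a + if v = a then 1 else 0) e := by
    have hpos : ∀ {x y}, H.Adj x y → 0 < H.degree x := fun {x y} h =>
      (H.degree_pos_iff_exists_adj x).2 ⟨y, h⟩
    have hend : ∀ {x}, H.Adj v x → invSqrt (H.degree v + H.degree x)
        - invSqrtGap (H.degree v + 1) ≤ invSqrt (H.degree v + H.degree x + 1) := fun {x} h =>
      sub_le_comm.1 <| invSqrtGap_le_invSqrtGap (Nat.succ_pos _)
        (Nat.add_le_add_left (hpos h.symm) (H.degree v))
    rintro ⟨x, y⟩ he
    have hxy : H.Adj x y := by simpa using he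
    rcases eq_or_ne v x with rfl | hx
    · simpa [weight, hxy.ne, add_right_comm] using hend hxy
    rcases eq_or_ne v y with rfl | hy
    · simpa [weight, hx, add_comm, add_left_comm] using hend hxy.symm
    · simp [weight, hx, hy]
  have hsum := Finset.sum_le_sum hedge
  rw [Finset.sum_sub_distrib, sum_edgeFinset_ite_mem, ← sumConnectivity_eq] at hsum
  have hfibre : ∀ a, (Finset.univ.filter fun _ : Unit => v = a).card = if v = a then 1 else 0 :=
    fun a => by split_ifs with h <;> simp [h]
  rw [sumConnectivity_attachPendents, starGain_eq_sub_mul_invSqrtGap]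
  simp only [hfibre, Finset.filter_true, Finset.card_univ, Fintype.card_unit, Fintype.sum_unique]
  unfold invSqrtGap at hsum ⊢
  push_cast
  linarith

end attachPendents

section isomorphism

variable {V W P : Type*} {G : SimpleGraph V} {H : SimpleGraph W}

theorem isUniversal_iso_apply (e : G ≃g H) {v : V} (hv : G.IsUniversal v) :
    H.IsUniversal (e v) := fun w hw => by
  have h : G.Adj v (e.symm w) := hv fun h => hw (e.eq_symm_apply.1 h)
  rwa [← e.map_adj_iff, e.apply_symm_apply] at h

/-- If the vertices of `G` outside the image of an induced copy `t` of `H` are enumerated by `q`,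
and `q p` is pendent at `t (f p)`, then `G` arises from `H` by attaching pendent vertices
along `f`. -/
def attachPendentsIso (t : H ↪g G) {f : P → W} {q : P → V}
    (hbij : Function.Bijective (Sum.elim t q)) (hadj : ∀ p x, G.Adj (q p) x ↔ x = t (f p)) :
    attachPendents H f ≃g G where
  toEquiv := Equiv.ofBijective _ hbij
  map_rel_iff' := by
    rintro (a | p) (b | p')
    · exact t.map_adj_iff
    · simp [G.adj_comm (t a), hadj, eq_comm]
    · simp [hadj, eq_comm]
    · have hne : q p' ≠ t (f p) := fun h => Sum.inr_ne_inl (hbij.1 (a₁ := Sum.inr p')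
        (a₂ := Sum.inl (f p)) h)
      simp [hadj, hne]

theorem bijective_sumElim_of_equiv_compl_range (t : H ↪g G) (k : P ≃ ↥(Set.range t)ᶜ) :
    Function.Bijective (Sum.elim t fun p => (k p : V)) := by
  refine ⟨t.injective.sumElim (Subtype.val_injective.comp k.injective)
    fun a p h => (k p).2 ⟨a, h⟩, fun x => ?_⟩
  by_cases hx : x ∈ Set.range t
  · obtain ⟨a, rfl⟩ := hx
    exact ⟨Sum.inl a, rfl⟩
  · exact ⟨Sum.inr (k.symm ⟨x, hx⟩), by simp⟩

/-- The degrees determine how many pendent vertices are attached at each vertex of `H`. -/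
theorem nonempty_iso_attachPendents [Fintype V] [Fintype W] [Fintype P] (t : H ↪g G) (f : P → W)
    (hpend : ∀ w ∉ Set.range t, ∃ i, ∀ x, G.Adj w x ↔ x = t i)
    (hdeg : ∀ i, G.degree (t i) = H.degree i + (Finset.univ.filter fun p => f p = i).card) :
    Nonempty (G ≃g attachPendents H f) := by
  choose g hg using fun w : ↥(Set.range t)ᶜ => hpend w w.2
  let e := attachPendentsIso t (bijective_sumElim_of_equiv_compl_range t (Equiv.refl _)) hg
  have hfibre : ∀ i, (Finset.univ.filter fun p => f p = i).card
      = (Finset.univ.filter fun w => g w = i).card := fun i => by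
    have h := (e.degree_eq (Sum.inl i)).symm.trans (hdeg i)
    rw [attachPendents_degree_inl] at h
    omega
  let k := Equiv.ofFiberEquiv fun i => Fintype.equivOfCardEq <|
    (Fintype.card_subtype _).trans <| (hfibre i).trans (Fintype.card_subtype _).symm
  refine ⟨(attachPendentsIso t (bijective_sumElim_of_equiv_compl_range t k) fun p x => ?_).symm⟩
  rw [hg (k p) x, Equiv.ofFiberEquiv_map (f := f) (g := g)]

theorem exists_iso_attachPendents_induce {u v : V} (hu : ∀ x, G.Adj u x ↔ x = v) :
    ∃ w, Nonempty (attachPendents (G.induce {u}ᶜ) (fun _ : Unit => w) ≃g G) := by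
  refine ⟨⟨v, ((hu v).2 rfl).ne'⟩, ⟨attachPendentsIso (Embedding.induce {u}ᶜ) (q := fun _ => u)
    ⟨?_, fun x => ?_⟩ fun _ x => hu x⟩⟩
  · exact Subtype.val_injective.sumElim (Function.injective_of_subsingleton _) fun a _ => a.2
  · rcases eq_or_ne x u with rfl | hx
    · exact ⟨Sum.inr (), rfl⟩
    · exact ⟨Sum.inl ⟨x, hx⟩, rfl⟩

theorem exists_iso_attachPendents_of_degree_eq_one.{u} {V : Type u} [Fintype V] {G : SimpleGraph V}
    (hG : G ∈ bicyclicGraphs V) {u : V} (hu : G.degree u = 1) :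
    ∃ (W : Type u) (_ : Fintype W) (H : SimpleGraph W) (w : W), H ∈ bicyclicGraphs W ∧
      Nonempty (attachPendents H (fun _ : Unit => w) ≃g G) := by
  obtain ⟨v, hv, hv_unique⟩ := degree_eq_one_iff_existsUnique_adj.1 hu
  obtain ⟨w, ⟨e⟩⟩ := exists_iso_attachPendents_induce
    fun x => ⟨hv_unique x, fun h => h ▸ hv⟩
  exact ⟨_, inferInstance, _, w, (attachPendents_mem_bicyclicGraphs_iff _
    (hG.1.induce_compl_singleton_of_degree_eq_one hu)).1 (mem_bicyclicGraphs_congr e.symm hG), ⟨e⟩⟩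

end isomorphism

section namedGraphs

theorem edgeFinset_diamond :
    diamond.edgeFinset = {s(0, 1), s(0, 2), s(0, 3), s(1, 2), s(1, 3)} := by
  ext e
  rw [mem_edgeFinset, diamond, edgeSet_fromEdgeSet]
  simp only [Set.mem_sdiff, Set.mem_insert_iff, Set.mem_singleton_iff, Finset.mem_insert,
    Finset.mem_singleton, and_iff_left_iff_imp]
  rintro (rfl | rfl | rfl | rfl | rfl) <;> simp

theorem sum_edgeFinset_diamond {M : Type*} [AddCommMonoid M] (φ : Sym2 (Fin 4) → M) :
    ∑ e ∈ diamond.edgeFinset, φ e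
      = φ s(0, 1) + (φ s(0, 2) + (φ s(0, 3) + (φ s(1, 2) + φ s(1, 3)))) := by
  rw [edgeFinset_diamond]
  simp

theorem diamond_mem_bicyclicGraphs : diamond ∈ bicyclicGraphs (Fin 4) := by
  refine ⟨Connected.of_isUniversal (v := 0) fun w hw => ?_, ?_⟩
  · fin_cases w <;> simp [diamond] at hw ⊢
  · simp [edgeFinset_diamond]

theorem degree_diamond (a : Fin 4) : diamond.degree a = ![3, 3, 2, 2] a := by
  have hnbr : diamond.neighborFinset a = ![{1, 2, 3}, {0, 2, 3}, {0, 1}, {0, 1}] a := by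
    ext x
    rw [mem_neighborFinset]
    fin_cases a <;> fin_cases x <;> simp [diamond]
  rw [← card_neighborFinset_eq_degree, hnbr]
  fin_cases a <;> simp

theorem edgeFinset_bowtie :
    bowtie.edgeFinset = {s(0, 1), s(0, 2), s(1, 2), s(0, 3), s(0, 4), s(3, 4)} := by
  ext e
  rw [mem_edgeFinset, bowtie, edgeSet_fromEdgeSet]
  simp only [Set.mem_sdiff, Set.mem_insert_iff, Set.mem_singleton_iff, Finset.mem_insert,
    Finset.mem_singleton, and_iff_left_iff_imp]
  rintro (rfl | rfl | rfl | rfl | rfl | rfl) <;> simp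

theorem sum_edgeFinset_bowtie {M : Type*} [AddCommMonoid M] (φ : Sym2 (Fin 5) → M) :
    ∑ e ∈ bowtie.edgeFinset, φ e
      = φ s(0, 1) + (φ s(0, 2) + (φ s(1, 2) + (φ s(0, 3) + (φ s(0, 4) + φ s(3, 4))))) := by
  rw [edgeFinset_bowtie]
  simp

theorem bowtie_mem_bicyclicGraphs : bowtie ∈ bicyclicGraphs (Fin 5) := by
  refine ⟨Connected.of_isUniversal (v := 0) fun w hw => ?_, ?_⟩
  · fin_cases w <;> simp [bowtie] at hw ⊢
  · simp [edgeFinset_bowtie]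

theorem degree_bowtie (a : Fin 5) : bowtie.degree a = ![4, 2, 2, 2, 2] a := by
  have hnbr : bowtie.neighborFinset a = ![{1, 2, 3, 4}, {0, 2}, {0, 1}, {0, 4}, {0, 3}] a := by
    ext x
    rw [mem_neighborFinset]
    fin_cases a <;> fin_cases x <;> simp [bowtie]
  rw [← card_neighborFinset_eq_degree, hnbr]
  fin_cases a <;> simp

theorem graphB_mem_bicyclicGraphs (a b : ℕ) : graphB a b ∈ bicyclicGraphs _ :=
  attachPendents_mem_bicyclicGraphs _ diamond_mem_bicyclicGraphs

theorem graphBThree_mem_bicyclicGraphs (n : ℕ) : graphBThree n ∈ bicyclicGraphs _ :=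
  attachPendents_mem_bicyclicGraphs _ bowtie_mem_bicyclicGraphs

theorem graphFive_mem_bicyclicGraphs : graphFive ∈ bicyclicGraphs _ :=
  attachPendents_mem_bicyclicGraphs _ diamond_mem_bicyclicGraphs

theorem card_filter_sumElim_eq (k l : ℕ) (i : Fin 4)
    [DecidablePred fun p : Fin k ⊕ Fin l => Sum.elim (fun _ => (0 : Fin 4)) (fun _ => 1) p = i] :
    (Finset.univ.filter fun p : Fin k ⊕ Fin l =>
      Sum.elim (fun _ => (0 : Fin 4)) (fun _ => 1) p = i).card = ![k, l, 0, 0] i := by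
  rw [Finset.card_filter, Fintype.sum_sum_type]
  fin_cases i <;> simp

theorem sumConnectivity_graphB {a b : ℕ} (ha : 3 ≤ a) (hb : 3 ≤ b) :
    sumConnectivity (graphB a b) = invSqrt (a + b) + 2 * invSqrt (a + 2) + 2 * invSqrt (b + 2)
      + ((a : ℝ) - 3) * invSqrt (a + 1) + ((b : ℝ) - 3) * invSqrt (b + 1) := by
  obtain ⟨a, rfl⟩ := Nat.exists_eq_add_of_le ha
  obtain ⟨b, rfl⟩ := Nat.exists_eq_add_of_le hb
  rw [graphB, sumConnectivity_attachPendents, sum_edgeFinset_diamond, Fintype.sum_sum_type]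
  simp only [weight_mk, card_filter_sumElim_eq, degree_diamond]
  simp
  ring

theorem sumConnectivity_graphBThree {n : ℕ} (hn : 5 ≤ n) :
    sumConnectivity (graphBThree n) = 4 * invSqrt (n + 1) + ((n : ℝ) - 5) * invSqrt n + 1 := by
  obtain ⟨n, rfl⟩ := Nat.exists_eq_add_of_le hn
  rw [graphBThree, sumConnectivity_attachPendents, sum_edgeFinset_bowtie]
  simp [degree_bowtie, invSqrt_four]
  ring_nf

theorem sumConnectivity_graphFive :
    sumConnectivity graphFive = 3 * invSqrt 6 + 2 * invSqrt 5 + 1 / 2 := by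
  rw [graphFive, sumConnectivity_attachPendents, sum_edgeFinset_diamond]
  simp [degree_diamond, invSqrt_four]
  ring

theorem sumConnectivity_graphB_three {n : ℕ} (hn : 4 ≤ n) :
    sumConnectivity (graphB (n - 1) 3)
      = invSqrt (n + 2) + ((n : ℝ) - 4) * invSqrt n + 2 * invSqrt (n + 1) + 2 * invSqrt 5 := by
  obtain ⟨n, rfl⟩ := Nat.exists_eq_add_of_le' hn
  rw [sumConnectivity_graphB (by omega) le_rfl, show n + 4 - 1 = n + 3 by omega]
  push_cast
  ring

theorem sumConnectivity_graphB_four {n : ℕ} (hn : 5 ≤ n) :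
    sumConnectivity (graphB (n - 2) 4)
      = invSqrt (n + 2) + 2 * invSqrt n + ((n : ℝ) - 5) * invSqrt (n - 1) + 2 * invSqrt 6
        + invSqrt 5 := by
  obtain ⟨n, rfl⟩ := Nat.exists_eq_add_of_le' hn
  rw [sumConnectivity_graphB (by omega) (by omega), show n + 5 - 2 = n + 3 by omega]
  push_cast
  ring_nf

end namedGraphs

section comparison

theorem sumConnectivity_graphB_three_lt_graphBThree {n : ℕ} (hn : 5 ≤ n) :
    sumConnectivity (graphB (n - 1) 3) < sumConnectivity (graphBThree n) := by
  have hdiff : sumConnectivity (graphBThree n) - sumConnectivity (graphB (n - 1) 3)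
      = invSqrtGap (n + 1) - invSqrtGap n + (1 - 2 * invSqrt 5) := by
    rw [sumConnectivity_graphBThree hn, sumConnectivity_graphB_three (by omega)]
    unfold invSqrtGap
    ring
  have hgap : invSqrtGap n ≤ invSqrt 5 - invSqrt 6 :=
    invSqrtGap_le_invSqrtGap (m := 5) (by norm_num) hn
  have hgap_pos := invSqrtGap_pos (m := n + 1) n.succ_pos
  linarith [invSqrt_five_bounds.2, invSqrt_six_bounds.1]

theorem sumConnectivity_graphBThree_succ_lt {n : ℕ} (hn : 7 ≤ n) :
    sumConnectivity (graphBThree (n + 1))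
      < sumConnectivity (graphBThree n) + starGain (n - 1) := by
  obtain ⟨m, rfl⟩ := Nat.exists_eq_add_of_le' (show 1 ≤ n by omega)
  have hm : (6 : ℝ) ≤ m := by exact_mod_cast (show 6 ≤ m by omega)
  have hdiff : sumConnectivity (graphBThree (m + 1)) + starGain m
      - sumConnectivity (graphBThree (m + 1 + 1))
        = (m - 3) * invSqrtGap (m + 1) + 4 * invSqrtGap (m + 2) - (m - 1) * invSqrtGap m := by
    rw [sumConnectivity_graphBThree (by omega), sumConnectivity_graphBThree (by omega)]
    unfold starGain invSqrtGap
    push_cast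
    ring
  have hratio := two_mul_invSqrtGap_le (m := m) (by omega)
  have hratio' := two_mul_invSqrtGap_le (m := m + 1) (by omega)
  push_cast at hratio'
  have hgap := invSqrtGap_pos (m := m + 1) (by omega)
  have hscaled : 0 < 2 * (m : ℝ) * (2 * m + 5) * ((m - 3) * invSqrtGap (m + 1)
      + 4 * invSqrtGap (m + 2) - (m - 1) * invSqrtGap m) := by
    have hpoly : 0 < (2 * (m : ℝ) ^ 2 - 13 * m + 15) * invSqrtGap (m + 1) :=
      mul_pos (by nlinarith) hgap
    have hcoeff : 0 ≤ ((m : ℝ) - 1) * (2 * m + 5) := by nlinarith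
    linear_combination hpoly + mul_le_mul_of_nonneg_left hratio hcoeff + 8 * m * hratio'
  have := pos_of_mul_pos_right hscaled (by positivity)
  rw [Nat.add_sub_cancel]
  linarith

theorem sumConnectivity_graphB_four_add_starGain_le {n : ℕ} (hn : 5 ≤ n) :
    sumConnectivity (graphB (n - 2) 4) + starGain (n - 1)
      ≤ sumConnectivity (graphB (n + 1 - 2) 4) := by
  rw [sumConnectivity_graphB_four hn, sumConnectivity_graphB_four (by omega)]
  obtain ⟨m, rfl⟩ := Nat.exists_eq_add_of_le' (show 1 ≤ n by omega)
  have hgap := invSqrtGap_le_invSqrtGap (m := m) (k := m + 1) (by omega) (by omega)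
  have hgap' := invSqrtGap_le_invSqrtGap (m := m) (k := m + 3) (by omega) (by omega)
  simp only [Nat.add_sub_cancel]
  unfold starGain
  unfold invSqrtGap at hgap hgap'
  push_cast
  linarith

theorem sumConnectivity_graphBThree_lt_graphB_four {n : ℕ} (hn : 8 ≤ n) :
    sumConnectivity (graphBThree n) < sumConnectivity (graphB (n - 2) 4) := by
  induction n, hn using Nat.le_induction with
  | base =>
    rw [sumConnectivity_graphBThree (by norm_num), sumConnectivity_graphB_four (by norm_num)]
    norm_num
    linarith [invSqrt_five_bounds.1, invSqrt_six_bounds.1, invSqrt_seven_bounds.1,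
      invSqrt_eight_bounds.1, invSqrt_eight_bounds.2, invSqrt_nine, invSqrt_ten_bounds.1]
  | succ n hn ih =>
    calc sumConnectivity (graphBThree (n + 1))
        < sumConnectivity (graphBThree n) + starGain (n - 1) :=
          sumConnectivity_graphBThree_succ_lt (by omega)
      _ ≤ sumConnectivity (graphB (n - 2) 4) + starGain (n - 1) := by gcongr
      _ ≤ sumConnectivity (graphB (n + 1 - 2) 4) :=
          sumConnectivity_graphB_four_add_starGain_le (by omega)

theorem sumConnectivity_graphBThree_succ_lt_add_starGain_three {n : ℕ} (hn : 8 ≤ n) :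
    sumConnectivity (graphBThree (n + 1))
      < sumConnectivity (graphB (n - 1) 3) + starGain 3 := by
  have hdiff : sumConnectivity (graphBThree (n + 1)) - sumConnectivity (graphB (n - 1) 3)
      = starGain (n + 1) + 2 * invSqrtGap (n + 1) - (n - 4) * (invSqrtGap n - invSqrtGap (n + 1))
        + 1 - 2 * invSqrt 5 := by
    rw [sumConnectivity_graphBThree (by omega), sumConnectivity_graphB_three (by omega)]
    unfold starGain invSqrtGap
    push_cast
    ring
  have hgap : 0 ≤ ((n : ℝ) - 4) * (invSqrtGap n - invSqrtGap (n + 1)) := by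
    have hn' : (8 : ℝ) ≤ n := by exact_mod_cast hn
    exact mul_nonneg (by linarith)
      (sub_nonneg.2 (invSqrtGap_le_invSqrtGap (by omega) n.le_succ))
  have hgap_nine : invSqrtGap (n + 1) ≤ invSqrt 9 - invSqrt 10 :=
    invSqrtGap_le_invSqrtGap (m := 9) (by norm_num) (by omega)
  have hgain_nine : starGain (n + 1) ≤ starGain 9 :=
    starGain_antitoneOn (by simp) (by simp) (by omega)
  have hgain_nine_eq : starGain 9 = 9 * invSqrt 10 - 8 * invSqrt 9 := by
    norm_num [starGain]
  have hgain_three_eq : starGain 3 = 3 * invSqrt 4 - 2 * invSqrt 3 := by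
    norm_num [starGain]
  linarith [invSqrt_three_bounds.2, invSqrt_four, invSqrt_five_bounds.1, invSqrt_nine,
    invSqrt_ten_bounds.2]

end comparison

section structureTheorems

variable {V : Type*} {G : SimpleGraph V}

theorem exists_diamond_embedding {a b c d : V} (hab : G.Adj a b) (hac : G.Adj a c)
    (had : G.Adj a d) (hbc : G.Adj b c) (hbd : G.Adj b d) (hcd : ¬ G.Adj c d) (hne : c ≠ d) :
    ∃ t : diamond ↪g G, ⇑t = ![a, b, c, d] := by
  refine ⟨⟨⟨![a, b, c, d], fun i j => ?_⟩, fun {i j} => ?_⟩, rfl⟩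
  · fin_cases i <;> fin_cases j <;>
      simp [hab.ne, hac.ne, had.ne, hbc.ne, hbd.ne, hne, hab.ne', hac.ne', had.ne', hbc.ne',
        hbd.ne', hne.symm]
  · change G.Adj (![a, b, c, d] i) (![a, b, c, d] j) ↔ _
    fin_cases i <;> fin_cases j <;>
      simp [diamond, hab, hac, had, hbc, hbd, hcd, hab.symm, hac.symm, had.symm, hbc.symm,
        hbd.symm, G.adj_comm d c]

theorem exists_bowtie_embedding {c p q r s : V} (hcp : G.Adj c p) (hcq : G.Adj c q)
    (hcr : G.Adj c r) (hcs : G.Adj c s) (hpq : G.Adj p q) (hrs : G.Adj r s)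
    (hne : p ≠ r ∧ p ≠ s ∧ q ≠ r ∧ q ≠ s)
    (hnadj : ¬ G.Adj p r ∧ ¬ G.Adj p s ∧ ¬ G.Adj q r ∧ ¬ G.Adj q s) :
    ∃ t : bowtie ↪g G, ⇑t = ![c, p, q, r, s] := by
  obtain ⟨hpr, hps, hqr, hqs⟩ := hne
  refine ⟨⟨⟨![c, p, q, r, s], fun i j => ?_⟩, fun {i j} => ?_⟩, rfl⟩
  · fin_cases i <;> fin_cases j <;>
      simp [hcp.ne, hcq.ne, hcr.ne, hcs.ne, hpq.ne, hrs.ne, hpr, hps, hqr, hqs, hcp.ne', hcq.ne',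
        hcr.ne', hcs.ne', hpq.ne', hrs.ne', hpr.symm, hps.symm, hqr.symm, hqs.symm]
  · change G.Adj (![c, p, q, r, s] i) (![c, p, q, r, s] j) ↔ _
    fin_cases i <;> fin_cases j <;>
      simp [bowtie, hcp, hcq, hcr, hcs, hpq, hrs, hnadj, hcp.symm, hcq.symm, hcr.symm, hcs.symm,
        hpq.symm, hrs.symm, G.adj_comm r, G.adj_comm s p, G.adj_comm s q]

variable [Fintype V]

theorem three_le_degree_of_adj {v a b c : V} (ha : G.Adj v a) (hb : G.Adj v b) (hc : G.Adj v c)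
    (hab : a ≠ b) (hac : a ≠ c) (hbc : b ≠ c) : 3 ≤ G.degree v := by
  rw [← card_neighborFinset_eq_degree, ← Finset.card_eq_three.2 ⟨a, b, c, hab, hac, hbc, rfl⟩]
  exact Finset.card_le_card (by simp [Finset.insert_subset_iff, ha, hb, hc])

theorem card_incidenceFinset_union_add {u v : V} (huv : u ≠ v) :
    (G.incidenceFinset u ∪ G.incidenceFinset v).card + (if G.Adj u v then 1 else 0)
      = G.degree u + G.degree v := by
  have hinter : (G.incidenceFinset u ∩ G.incidenceFinset v).card = if G.Adj u v then 1 else 0 := by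
    split_ifs with h
    · refine Finset.card_eq_one.2 ⟨s(u, v), Finset.coe_injective ?_⟩
      simpa using G.incidenceSet_inter_incidenceSet_of_adj h
    · refine Finset.card_eq_zero.2 (Finset.coe_injective ?_)
      simpa using G.incidenceSet_inter_incidenceSet_of_not_adj h huv
  rw [← hinter, Finset.card_union_add_card_inter]
  simp only [card_incidenceFinset_eq_degree]

theorem adj_and_forall_adj_of_degree_add_degree (hG : G ∈ bicyclicGraphs V) {u v : V}
    (huv : u ≠ v) (hdeg : G.degree u + G.degree v = Fintype.card V + 2) :
    G.Adj u v ∧ ∀ a b, G.Adj a b → (a = u ∨ a = v) ∨ (b = u ∨ b = v) := by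
  have hsub : G.incidenceFinset u ∪ G.incidenceFinset v ⊆ G.edgeFinset :=
    Finset.union_subset (G.incidenceFinset_subset u) (G.incidenceFinset_subset v)
  have hle := Finset.card_le_card hsub
  have hcard := card_incidenceFinset_union_add (G := G) huv
  have hedges : G.edgeFinset.card = Fintype.card V + 1 := hG.2
  have hadj : G.Adj u v := by
    by_contra h
    rw [if_neg h] at hcard
    omega
  refine ⟨hadj, fun a b hab => ?_⟩
  rw [if_pos hadj] at hcard
  have hmem : s(a, b) ∈ G.incidenceFinset u ∪ G.incidenceFinset v := by
    rw [Finset.eq_of_subset_of_card_le hsub (by omega)]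
    simpa using hab
  simp only [Finset.mem_union, mem_incidenceFinset, mk'_mem_incidenceSet_iff] at hmem
  grind

theorem exists_common_neighbors_of_degree_add_degree (hG : G ∈ bicyclicGraphs V) {u v : V}
    (huv : u ≠ v) (hdeg : G.degree u + G.degree v = Fintype.card V + 2) :
    ∃ x y, x ≠ y ∧ ∀ w, G.Adj u w ∧ G.Adj v w ↔ w = x ∨ w = y := by
  obtain ⟨hadj, hcover⟩ := adj_and_forall_adj_of_degree_add_degree hG huv hdeg
  have hunion : G.neighborFinset u ∪ G.neighborFinset v = Finset.univ := by
    refine Finset.eq_univ_of_forall fun w => ?_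
    obtain ⟨z, hz⟩ := (G.degree_pos_iff_exists_adj w).1 (degree_pos_of_mem_bicyclicGraphs hG w)
    simp only [Finset.mem_union, mem_neighborFinset]
    rcases hcover w z hz with (rfl | rfl) | (rfl | rfl)
    · exact Or.inr hadj.symm
    · exact Or.inl hadj
    · exact Or.inl hz.symm
    · exact Or.inr hz.symm
  have hcard := Finset.card_union_add_card_inter (G.neighborFinset u) (G.neighborFinset v)
  rw [hunion, Finset.card_univ, card_neighborFinset_eq_degree, card_neighborFinset_eq_degree,
    hdeg, Nat.add_left_cancel_iff] at hcard
  obtain ⟨x, y, hxy, hinter⟩ := Finset.card_eq_two.1 hcard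
  exact ⟨x, y, hxy, fun w => by simpa using Finset.ext_iff.1 hinter w⟩

theorem forall_adj_iff_eq_of_degree_add_degree (hG : G ∈ bicyclicGraphs V) {u v : V}
    (huv : u ≠ v) (hdeg : G.degree u + G.degree v = Fintype.card V + 2) {w : V} (hwu : w ≠ u)
    (hwv : w ≠ v) (hnot : ¬ (G.Adj u w ∧ G.Adj v w)) :
    (∀ x, G.Adj w x ↔ x = u) ∨ ∀ x, G.Adj w x ↔ x = v := by
  have hcover (x : V) (hx : G.Adj w x) : x = u ∨ x = v := by
    have := (adj_and_forall_adj_of_degree_add_degree hG huv hdeg).2 w x hx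
    tauto
  obtain ⟨z, hz⟩ := (G.degree_pos_iff_exists_adj w).1 (degree_pos_of_mem_bicyclicGraphs hG w)
  rcases hcover z hz with rfl | rfl
  · exact Or.inl fun x => by grind [hcover x, hz.symm, G.adj_comm]
  · exact Or.inr fun x => by grind [hcover x, hz.symm, G.adj_comm]

theorem nonempty_iso_graphB_of_degree_add_degree (hG : G ∈ bicyclicGraphs V) {u v : V}
    (huv : u ≠ v) (hdeg : G.degree u + G.degree v = Fintype.card V + 2) :
    Nonempty (G ≃g graphB (G.degree u) (G.degree v)) := by
  obtain ⟨hadj, hcover⟩ := adj_and_forall_adj_of_degree_add_degree hG huv hdeg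
  obtain ⟨x, y, hxy, hcommon⟩ := exists_common_neighbors_of_degree_add_degree hG huv hdeg
  obtain ⟨hux, hvx⟩ := (hcommon x).2 (Or.inl rfl)
  obtain ⟨huy, hvy⟩ := (hcommon y).2 (Or.inr rfl)
  have hnadj : ¬ G.Adj x y := fun h => by grind [hcover x y h, hux.ne, hvx.ne, huy.ne, hvy.ne]
  obtain ⟨t, ht⟩ := exists_diamond_embedding hadj hux huy hvx hvy hnadj hxy
  have hu := three_le_degree_of_adj hadj hux huy hvx.ne hvy.ne hxy
  have hv := three_le_degree_of_adj hadj.symm hvx hvy hux.ne huy.ne hxy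
  have htwo {z : V} (hzu : G.Adj u z) (hzv : G.Adj v z) : G.degree z = 2 := by
    rw [← card_neighborFinset_eq_degree, ← Finset.card_pair huv]
    congr 1
    ext w
    simp only [mem_neighborFinset, Finset.mem_insert, Finset.mem_singleton]
    grind [hcover z w, hzu.ne, hzv.ne, hzu.symm, hzv.symm]
  have hdegree (i : Fin 4) :
      G.degree (![u, v, x, y] i) = ![G.degree u, G.degree v, 2, 2] i := by
    fin_cases i
    exacts [rfl, rfl, htwo hux hvx, htwo huy hvy]
  refine nonempty_iso_attachPendents t _ (fun w hw => ?_) fun i => ?_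
  · obtain ⟨hwy, hwx, hwv, hwu⟩ : w ≠ y ∧ w ≠ x ∧ w ≠ v ∧ w ≠ u := by
      simpa [ht, eq_comm (b := w)] using hw
    have hnot : ¬ (G.Adj u w ∧ G.Adj v w) := fun h => by grind [(hcommon w).1 h]
    rw [ht]
    rcases forall_adj_iff_eq_of_degree_add_degree hG huv hdeg hwu hwv hnot with h | h
    exacts [⟨0, h⟩, ⟨1, h⟩]
  · rw [ht, hdegree, degree_diamond, card_filter_sumElim_eq]
    fin_cases i <;> simp <;> omega

theorem degree_add_degree_le (hG : G ∈ bicyclicGraphs V) {u v : V} (huv : u ≠ v) :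
    G.degree u + G.degree v ≤ Fintype.card V + 2 := by
  have h := sum_degree_le_card_edgeFinset_add_choose G {u, v}
  rwa [Finset.sum_pair huv, Finset.card_pair huv, hG.2] at h

theorem nonempty_iso_graphB_of_three_le_degree (hG : G ∈ bicyclicGraphs V) {c x : V}
    (hc : G.IsUniversal c) (hcx : c ≠ x) (hx : 3 ≤ G.degree x) :
    Nonempty (G ≃g graphB (Fintype.card V - 1) 3) := by
  have hdegc : G.degree c = Fintype.card V - 1 := (G.degree_eq_card_sub_one c).2 hc
  have hpos : 0 < Fintype.card V := Fintype.card_pos_iff.2 ⟨c⟩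
  have hle := degree_add_degree_le hG hcx
  have hdegx : G.degree x = 3 := by omega
  have h := nonempty_iso_graphB_of_degree_add_degree hG hcx (by omega)
  rwa [hdegc, hdegx] at h

theorem exists_edges_of_isUniversal (hG : G ∈ bicyclicGraphs V) {c : V} (hc : G.IsUniversal c) :
    ∃ e f, e ≠ f ∧ ∀ g, g ∈ G.edgeSet ∧ c ∉ g ↔ g = e ∨ g = f := by
  have hcard : (G.edgeFinset \ G.incidenceFinset c).card = 2 := by
    have hpos : 0 < Fintype.card V := Fintype.card_pos_iff.2 ⟨c⟩
    rw [Finset.card_sdiff_of_subset (G.incidenceFinset_subset c), card_incidenceFinset_eq_degree,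
      (G.degree_eq_card_sub_one c).2 hc, hG.2]
    omega
  obtain ⟨e, f, hne, hedges⟩ := Finset.card_eq_two.1 hcard
  refine ⟨e, f, hne, fun g => ?_⟩
  have hmem := Finset.ext_iff.1 hedges g
  simp only [Finset.mem_sdiff, mem_edgeFinset, mem_incidenceFinset, incidenceSet,
    Finset.mem_insert, Finset.mem_singleton, Set.mem_ofPred_eq] at hmem
  tauto

theorem exists_disjoint_edges_of_isUniversal (hG : G ∈ bicyclicGraphs V) {c : V}
    (hc : G.IsUniversal c) (hle : ∀ x, x ≠ c → G.degree x ≤ 2) :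
    ∃ p q r s, (p ≠ c ∧ q ≠ c ∧ r ≠ c ∧ s ≠ c) ∧ (p ≠ r ∧ p ≠ s ∧ q ≠ r ∧ q ≠ s) ∧
      ∀ a b, a ≠ c → b ≠ c → (G.Adj a b ↔ s(a, b) = s(p, q) ∨ s(a, b) = s(r, s)) := by
  have hunique {a b b' : V} (hab : G.Adj a b) (hab' : G.Adj a b') (ha : a ≠ c) (hb : b ≠ c)
      (hb' : b' ≠ c) : b = b' := by
    by_contra hne
    have h := three_le_degree_of_adj (hc ha.symm).symm hab hab' hb.symm hb'.symm hne
    exact absurd (hle a ha) (by omega)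
  obtain ⟨⟨p, q⟩, ⟨r, s⟩, hne, hedges⟩ := exists_edges_of_isUniversal hG hc
  obtain ⟨hpq, hp⟩ := (hedges s(p, q)).2 (Or.inl rfl)
  obtain ⟨hrs, hr⟩ := (hedges s(r, s)).2 (Or.inr rfl)
  rw [Sym2.mem_iff, not_or] at hp hr
  rw [mem_edgeSet] at hpq hrs
  rw [ne_eq, Sym2.eq_iff] at hne
  refine ⟨p, q, r, s, ⟨Ne.symm hp.1, Ne.symm hp.2, Ne.symm hr.1, Ne.symm hr.2⟩, ?_,
    fun a b ha hb => ?_⟩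
  · grind [hpq.symm, hrs.symm]
  · rw [← hedges s(a, b), mem_edgeSet, Sym2.mem_iff]
    tauto

theorem nonempty_iso_graphBThree_of_isUniversal (hG : G ∈ bicyclicGraphs V) {c : V}
    (hc : G.IsUniversal c) (hle : ∀ x, x ≠ c → G.degree x ≤ 2) :
    Nonempty (G ≃g graphBThree (Fintype.card V)) := by
  obtain ⟨p, q, r, s, ⟨hp, hq, hr, hs⟩, hne, hedges⟩ :=
    exists_disjoint_edges_of_isUniversal hG hc hle
  have hpq : G.Adj p q := (hedges p q hp hq).2 (Or.inl rfl)
  have hrs : G.Adj r s := (hedges r s hr hs).2 (Or.inr rfl)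
  simp only [Sym2.eq_iff] at hedges
  obtain ⟨t, ht⟩ := exists_bowtie_embedding (hc hp.symm) (hc hq.symm) (hc hr.symm) (hc hs.symm)
    hpq hrs hne (by grind)
  have htwo {a b : V} (ha : a ≠ c) (hb : b ≠ c) (hab : G.Adj a b) : G.degree a = 2 := by
    refine (hle a ha).antisymm ?_
    rw [← card_neighborFinset_eq_degree, ← Finset.card_pair hb]
    exact Finset.card_le_card (by simp [Finset.insert_subset_iff, hab, (hc ha.symm).symm])
  have hdegree (i : Fin 5) :
      G.degree (![c, p, q, r, s] i) = ![Fintype.card V - 1, 2, 2, 2, 2] i := by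
    fin_cases i
    exacts [(G.degree_eq_card_sub_one c).2 hc, htwo hp hq hpq, htwo hq hp hpq.symm,
      htwo hr hs hrs, htwo hs hr hrs.symm]
  refine nonempty_iso_attachPendents t _ (fun w hw => ⟨0, fun x => ?_⟩) fun i => ?_
  · obtain ⟨hws, hwr, hwq, hwp, hwc⟩ : w ≠ s ∧ w ≠ r ∧ w ≠ q ∧ w ≠ p ∧ w ≠ c := by
      simpa [ht, eq_comm (b := w)] using hw
    rw [ht]
    change G.Adj w x ↔ x = c
    grind [(hc hwc.symm).symm]
  · have hcard : 5 ≤ Fintype.card V := by simpa using Fintype.card_le_of_injective t t.injective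
    rw [ht, hdegree, degree_bowtie]
    fin_cases i <;> simp
    omega

theorem nonempty_iso_of_isUniversal (hG : G ∈ bicyclicGraphs V) {c : V} (hc : G.IsUniversal c) :
    Nonempty (G ≃g graphB (Fintype.card V - 1) 3) ∨
      Nonempty (G ≃g graphBThree (Fintype.card V)) := by
  by_cases h : ∃ x, x ≠ c ∧ 3 ≤ G.degree x
  · obtain ⟨x, hxc, hx⟩ := h
    exact Or.inl (nonempty_iso_graphB_of_three_le_degree hG hc hxc.symm hx)
  · push Not at h
    exact Or.inr (nonempty_iso_graphBThree_of_isUniversal hG hc fun x hx =>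
      Nat.le_of_lt_succ (h x hx))

theorem adj_of_degree_add_two_eq {u v : V} (huv : u ≠ v) (hnadj : ¬ G.Adj v u)
    (hdeg : G.degree v + 2 = Fintype.card V) {x : V} (hxu : x ≠ u) (hxv : x ≠ v) :
    G.Adj v x := by
  have hsub : G.neighborFinset v ⊆ Finset.univ \ {u, v} := fun y hy => by
    rw [mem_neighborFinset] at hy
    simp only [Finset.mem_sdiff, Finset.mem_univ, Finset.mem_insert, Finset.mem_singleton]
    grind [hy.ne]
  have hcard : (Finset.univ \ {u, v} : Finset V).card = G.degree v := by
    rw [Finset.card_sdiff_of_subset (Finset.subset_univ _), Finset.card_univ,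
      Finset.card_pair huv]
    omega
  rw [← mem_neighborFinset, Finset.eq_of_subset_of_card_le hsub (by simp [hcard])]
  simp [hxu, hxv]

theorem exists_degree_le_two_of_pendent (hcard : Fintype.card V = 5)
    (hle : ∀ v, G.degree v ≤ 3) {u w : V} (huw : ∀ x, G.Adj u x ↔ x = w) :
    ∃ z, z ≠ u ∧ z ≠ w ∧ G.degree z ≤ 2 := by
  by_contra! h
  have hw : G.IsUniversal w := fun v hv => by
    rcases eq_or_ne v u with rfl | hvu
    · exact ((huw w).2 rfl).symm
    · have hdeg := h v hvu hv.symm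
      have hnadj : ¬ G.Adj v u := fun hadj => hv.symm ((huw v).1 hadj.symm)
      exact (adj_of_degree_add_two_eq hvu.symm hnadj (by have := hle v; omega)
        ((huw w).2 rfl).ne' hv).symm
  have := (G.degree_eq_card_sub_one w).2 hw
  have := hle w
  omega

theorem exists_degrees_of_pendent (hG : G ∈ bicyclicGraphs V) (hcard : Fintype.card V = 5)
    (hle : ∀ v, G.degree v ≤ 3) {u w : V} (huw : ∀ x, G.Adj u x ↔ x = w) :
    ∃ x y z, (∀ v, v = u ∨ v = w ∨ v = x ∨ v = y ∨ v = z) ∧ [u, w, x, y, z].Nodup ∧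
      G.degree w = 3 ∧ G.degree x = 3 ∧ G.degree y = 3 ∧ G.degree z = 2 := by
  have hne : u ≠ w := ((huw w).2 rfl).ne
  obtain ⟨z, hzu, hzw, hz⟩ := exists_degree_le_two_of_pendent hcard hle huw
  have hrest : (Finset.univ \ {u, w, z} : Finset V).card = 2 := by
    rw [Finset.card_sdiff_of_subset (Finset.subset_univ _), Finset.card_univ, hcard,
      Finset.card_eq_three.2 ⟨u, w, z, hne, hzu.symm, hzw.symm, rfl⟩]
  obtain ⟨x, y, hxy, hrest⟩ := Finset.card_eq_two.1 hrest
  have hmem (v : V) := Finset.ext_iff.1 hrest v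
  simp only [Finset.mem_sdiff, Finset.mem_univ, true_and, Finset.mem_insert,
    Finset.mem_singleton, not_or] at hmem
  have hnodup : [u, w, x, y, z].Nodup := by
    have := hmem x
    have := hmem y
    grind
  have hu : G.degree u = 1 :=
    degree_eq_one_iff_existsUnique_adj.2 ⟨w, (huw w).2 rfl, fun x => (huw x).1⟩
  have hsum := sum_degree_of_mem_bicyclicGraphs hG
  rw [← Finset.sum_sdiff (Finset.subset_univ {u, w, z}), hrest, Finset.sum_pair hxy,
    Finset.sum_insert (by simp [hne, hzu.symm]), Finset.sum_pair hzw.symm] at hsum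
  have hw := hle w
  have hx := hle x
  have hy := hle y
  exact ⟨x, y, z, fun v => by have := hmem v; tauto, hnodup, by omega, by omega, by omega, by omega⟩

theorem exists_diamond_embedding_of_pendent (hG : G ∈ bicyclicGraphs V)
    (hcard : Fintype.card V = 5) (hle : ∀ v, G.degree v ≤ 3) {u w : V}
    (huw : ∀ x, G.Adj u x ↔ x = w) :
    ∃ t : diamond ↪g G, t 2 = w ∧ (∀ v ∉ Set.range t, v = u) ∧
      ∀ i, G.degree (t i) = ![3, 3, 3, 2] i := by
  obtain ⟨x, y, z, hall, hnodup, hw, hx, hy, hz⟩ := exists_degrees_of_pendent hG hcard hle huw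
  simp only [List.nodup_cons, List.mem_cons, List.not_mem_nil, not_or, or_false, ← ne_eq]
    at hnodup
  obtain ⟨⟨huw', hux, huy, huz⟩, ⟨hwx, hwy, hwz⟩, ⟨hxy, hxz⟩, hyz, -⟩ := hnodup
  have hadj {v a : V} (hv : G.degree v = 3) (huv : u ≠ v) (hwv : w ≠ v) (hua : u ≠ a)
      (hva : v ≠ a) : G.Adj v a :=
    adj_of_degree_add_two_eq huv (fun h => hwv ((huw v).1 h.symm).symm) (by omega) hua.symm
      hva.symm
  have hxy' : G.Adj x y := hadj hx hux hwx huy hxy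
  have hxw : G.Adj x w := hadj hx hux hwx huw' hwx.symm
  have hxz' : G.Adj x z := hadj hx hux hwx huz hxz
  have hyw : G.Adj y w := hadj hy huy hwy huw' hwy.symm
  have hyz' : G.Adj y z := hadj hy huy hwy huz hyz
  have hwz' : ¬ G.Adj w z := fun h => by
    have := three_le_degree_of_adj hxz'.symm hyz'.symm h.symm hxy hwx.symm hwy.symm
    omega
  obtain ⟨t, ht⟩ := exists_diamond_embedding hxy' hxw hxz' hyw hyz' hwz' hwz
  refine ⟨t, by rw [ht]; rfl, fun v hv => ?_, fun i => ?_⟩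
  · simp only [ht, Matrix.range_cons, Matrix.range_empty, Set.union_empty, Set.mem_union,
      Set.mem_singleton_iff] at hv
    have := hall v
    tauto
  · rw [ht]
    fin_cases i
    exacts [hx, hy, hw, hz]

theorem nonempty_iso_graphFive_of_pendent (hG : G ∈ bicyclicGraphs V)
    (hcard : Fintype.card V = 5) (hle : ∀ v, G.degree v ≤ 3) {u w : V}
    (huw : ∀ x, G.Adj u x ↔ x = w) : Nonempty (G ≃g graphFive) := by
  obtain ⟨t, htw, hrange, hdegree⟩ := exists_diamond_embedding_of_pendent hG hcard hle huw
  refine nonempty_iso_attachPendents t _ (fun v hv => ⟨2, ?_⟩) fun i => ?_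
  · rw [hrange v hv, htw]
    exact huw
  · rw [hdegree, degree_diamond]
    fin_cases i <;> simp

end structureTheorems

section smallOrder

variable {V : Type*} [Fintype V] {G : SimpleGraph V}

theorem le_sumConnectivity_of_firstZagreb_le (hG : G ∈ bicyclicGraphs V) {a M : ℕ} (ha : 0 < a)
    (hM : firstZagreb G ≤ M) :
    invSqrt a * (3 * a * (Fintype.card V + 1) - M) / (2 * a) ≤ sumConnectivity G := by
  refine le_trans ?_ (zagreb_le_sumConnectivity G ha)
  have hM' : (firstZagreb G : ℝ) ≤ M := by exact_mod_cast hM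
  have := (invSqrt_pos (Nat.cast_pos.2 ha)).le
  rw [hG.2]
  push_cast
  gcongr

theorem firstZagreb_add_le (hG : G ∈ bicyclicGraphs V) {l h : ℕ} (hl : ∀ v, l ≤ G.degree v)
    (hh : ∀ v, G.degree v ≤ h) :
    firstZagreb G + l * h * Fintype.card V ≤ (l + h) * (2 * (Fintype.card V + 1)) := by
  rw [← sum_degree_of_mem_bicyclicGraphs hG]
  exact sum_degree_sq_add_le G (fun v _ => hl v) fun v _ => hh v

theorem degree_add_two_le_of_not_isUniversal {v : V} (hv : ¬ G.IsUniversal v) :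
    G.degree v + 2 ≤ Fintype.card V := by
  have := (G.degree_lt_card_sub_one v).2 hv
  omega

theorem nonempty_iso_graphFive_or_sumConnectivity_lt (hG : G ∈ bicyclicGraphs V)
    (hcard : Fintype.card V = 5) (huniv : ∀ v, ¬ G.IsUniversal v) :
    Nonempty (G ≃g graphFive) ∨ sumConnectivity graphFive < sumConnectivity G := by
  have hle (v : V) : G.degree v ≤ 3 := by
    have := degree_add_two_le_of_not_isUniversal (huniv v)
    omega
  by_cases hpend : ∃ u, G.degree u = 1
  · obtain ⟨u, hu⟩ := hpend
    obtain ⟨w, hw, hunique⟩ := degree_eq_one_iff_existsUnique_adj.1 hu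
    exact Or.inl (nonempty_iso_graphFive_of_pendent hG hcard hle (w := w)
      fun x => ⟨hunique x, fun h => h ▸ hw⟩)
  · push Not at hpend
    have htwo (v : V) : 2 ≤ G.degree v := by
      have := degree_pos_of_mem_bicyclicGraphs hG v
      have := hpend v
      omega
    have hzagreb := firstZagreb_add_le hG htwo hle
    rw [hcard] at hzagreb
    have hbound := le_sumConnectivity_of_firstZagreb_le hG (a := 5) (M := 30) (by norm_num)
      (by omega)
    rw [hcard] at hbound
    norm_num at hbound
    rw [sumConnectivity_graphFive]
    exact Or.inr (by linarith [invSqrt_five_bounds.1, invSqrt_six_bounds.2])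

theorem exists_two_largest_degrees [Nontrivial V] (G : SimpleGraph V) :
    ∃ u v, u ≠ v ∧ G.degree v ≤ G.degree u ∧
      ∀ w, w ≠ u → w ≠ v → G.degree w ≤ G.degree v := by
  obtain ⟨u, -, hu⟩ := Finset.univ.exists_max_image (fun v => G.degree v) Finset.univ_nonempty
  obtain ⟨v, hv, hmax⟩ := (Finset.univ.erase u).exists_max_image (fun v => G.degree v)
    Finset.univ_nontrivial.erase_nonempty
  exact ⟨u, v, (Finset.ne_of_mem_erase hv).symm, hu v (Finset.mem_univ v),
    fun w hwu _ => hmax w (Finset.mem_erase.2 ⟨hwu, Finset.mem_univ w⟩)⟩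

theorem degree_add_degree_add_degree_le (hG : G ∈ bicyclicGraphs V) {u v w : V} (huv : u ≠ v)
    (huw : u ≠ w) (hvw : v ≠ w) :
    G.degree u + G.degree v + G.degree w ≤ Fintype.card V + 4 := by
  have h := sum_degree_le_card_edgeFinset_add_choose G {u, v, w}
  rwa [Finset.sum_insert (by simp [huv, huw]), Finset.sum_pair hvw,
    Finset.card_eq_three.2 ⟨u, v, w, huv, huw, hvw, rfl⟩, hG.2, ← add_assoc] at h

theorem sum_sdiff_pair_sq_add_le (hG : G ∈ bicyclicGraphs V) {u v : V} (huv : u ≠ v) {h : ℕ}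
    (hh : ∀ w, w ≠ u → w ≠ v → G.degree w ≤ h) :
    ∑ w ∈ Finset.univ \ {u, v}, G.degree w ^ 2 + h * (Fintype.card V - 2)
      ≤ (1 + h) * (2 * Fintype.card V + 2 - G.degree u - G.degree v) := by
  have hcard : (Finset.univ \ {u, v} : Finset V).card = Fintype.card V - 2 := by
    rw [Finset.card_sdiff_of_subset (Finset.subset_univ _), Finset.card_pair huv,
      Finset.card_univ]
  have hsum : ∑ w ∈ Finset.univ \ {u, v}, G.degree w
      = 2 * Fintype.card V + 2 - G.degree u - G.degree v := by
    have h := sum_degree_of_mem_bicyclicGraphs hG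
    rw [← Finset.sum_sdiff (Finset.subset_univ {u, v}), Finset.sum_pair huv] at h
    omega
  have hbound := sum_degree_sq_add_le G (S := Finset.univ \ {u, v}) (l := 1) (h := h)
    (fun w _ => degree_pos_of_mem_bicyclicGraphs hG w) fun w hw => by
      simp only [Finset.mem_sdiff, Finset.mem_insert, Finset.mem_singleton, not_or] at hw
      exact hh w hw.2.1 hw.2.2
  rwa [hcard, hsum, one_mul] at hbound

theorem sq_add_sq_add_le {n a b M : ℕ} (hn : 6 ≤ n) (hn' : n ≤ 8) (hb : 1 ≤ b) (hba : b ≤ a)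
    (ha : a + 2 ≤ n) (hab : a + b ≤ n + 2) (hne : ¬ (a = n - 2 ∧ b = 4))
    (h₁ : M + b * (n - 2) ≤ (1 + b) * (2 * n + 2 - a - b))
    (h₂ : M + (n + 4 - a - b) * (n - 2) ≤ (1 + (n + 4 - a - b)) * (2 * n + 2 - a - b)) :
    a ^ 2 + b ^ 2 + M + 3 * n ≤ n ^ 2 + 23 := by
  have hb' : b ≤ 6 := by omega
  have ha' : a ≤ 6 := by omega
  interval_cases n <;> interval_cases a <;> interval_cases b <;> omega

theorem firstZagreb_le_of_not_isUniversal (hG : G ∈ bicyclicGraphs V)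
    (hn : 6 ≤ Fintype.card V) (hn' : Fintype.card V ≤ 8) (huniv : ∀ v, ¬ G.IsUniversal v)
    (hiso : IsEmpty (G ≃g graphB (Fintype.card V - 2) 4)) :
    firstZagreb G + 3 * Fintype.card V ≤ Fintype.card V ^ 2 + 22 := by
  have : Nontrivial V := Fintype.one_lt_card_iff_nontrivial.1 (by omega)
  obtain ⟨u, v, huv, hvu, hmax⟩ := exists_two_largest_degrees G
  have hne : ¬ (G.degree u = Fintype.card V - 2 ∧ G.degree v = 4) := fun ⟨hu, hv⟩ => by
    have h := nonempty_iso_graphB_of_degree_add_degree hG huv (by omega)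
    rw [hu, hv] at h
    exact h.elim hiso.elim
  have hsplit : firstZagreb G = G.degree u ^ 2 + G.degree v ^ 2
      + ∑ w ∈ Finset.univ \ {u, v}, G.degree w ^ 2 := by
    rw [firstZagreb, ← Finset.sum_sdiff (Finset.subset_univ {u, v}), Finset.sum_pair huv,
      add_comm]
  have hle : firstZagreb G + 3 * Fintype.card V ≤ Fintype.card V ^ 2 + 23 := by
    rw [hsplit]
    refine sq_add_sq_add_le hn hn' (degree_pos_of_mem_bicyclicGraphs hG v) hvu
      (degree_add_two_le_of_not_isUniversal (huniv u)) (degree_add_degree_le hG huv) hne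
      (sum_sdiff_pair_sq_add_le hG huv hmax)
      (sum_sdiff_pair_sq_add_le hG huv fun w hwu hwv => ?_)
    have := degree_add_degree_add_degree_le hG huv hwu.symm hwv.symm
    omega
  obtain ⟨k, hk⟩ := even_firstZagreb G
  have hcases : Fintype.card V = 6 ∨ Fintype.card V = 7 ∨ Fintype.card V = 8 := by omega
  rcases hcases with h | h | h <;> rw [h] at hle ⊢ <;> omega

theorem nonempty_iso_graphB_four_or_sumConnectivity_lt (hG : G ∈ bicyclicGraphs V)
    (hcard : Fintype.card V = 6 ∨ Fintype.card V = 7) (huniv : ∀ v, ¬ G.IsUniversal v) :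
    Nonempty (G ≃g graphB (Fintype.card V - 2) 4) ∨
      sumConnectivity (graphB (Fintype.card V - 2) 4) < sumConnectivity G := by
  rcases isEmpty_or_nonempty (G ≃g graphB (Fintype.card V - 2) 4) with hiso | hiso
  · have hzagreb := firstZagreb_le_of_not_isUniversal hG (by omega) (by omega) huniv hiso
    right
    rw [sumConnectivity_graphB_four (by omega)]
    rcases hcard with h | h <;> rw [h] at hzagreb ⊢
    · have hbound := le_sumConnectivity_of_firstZagreb_le hG (a := 6) (M := 40) (by norm_num)
        (by omega)
      rw [h] at hbound
      norm_num at hbound ⊢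
      linarith [invSqrt_five_bounds.2, invSqrt_six_bounds.1, invSqrt_six_bounds.2,
        invSqrt_eight_bounds.2]
    · have hbound := le_sumConnectivity_of_firstZagreb_le hG (a := 6) (M := 50) (by norm_num)
        (by omega)
      rw [h] at hbound
      norm_num at hbound ⊢
      linarith [invSqrt_five_bounds.2, invSqrt_six_bounds.1, invSqrt_six_bounds.2,
        invSqrt_seven_bounds.2, invSqrt_nine]
  · exact Or.inl hiso

theorem sumConnectivity_graphBThree_lt_of_card_eq_eight (hG : G ∈ bicyclicGraphs V)
    (hcard : Fintype.card V = 8) (huniv : ∀ v, ¬ G.IsUniversal v) :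
    sumConnectivity (graphBThree 8) < sumConnectivity G := by
  rcases isEmpty_or_nonempty (G ≃g graphB (Fintype.card V - 2) 4) with hiso | ⟨⟨e⟩⟩
  · rw [sumConnectivity_graphBThree (by norm_num)]
    have hzagreb := firstZagreb_le_of_not_isUniversal hG (by omega) (by omega) huniv hiso
    rw [hcard] at hzagreb
    have hbound := le_sumConnectivity_of_firstZagreb_le hG (a := 7) (M := 62) (by norm_num)
      (by omega)
    rw [hcard] at hbound
    norm_num at hbound ⊢
    linarith [invSqrt_seven_bounds.1, invSqrt_eight_bounds.2, invSqrt_nine]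
  · rw [sumConnectivity_congr e, hcard]
    exact sumConnectivity_graphBThree_lt_graphB_four le_rfl

end smallOrder

section starGainInduction

variable {V : Type*} [Fintype V] {G : SimpleGraph V}

theorem degree_le_four_of_two_le_degree (hG : G ∈ bicyclicGraphs V)
    (htwo : ∀ v, 2 ≤ G.degree v) (v : V) : G.degree v ≤ 4 := by
  have hrest := (Finset.univ.erase v).card_nsmul_le_sum (fun w => G.degree w) 2
    fun w _ => htwo w
  have hsum := Finset.add_sum_erase Finset.univ (fun w => G.degree w) (Finset.mem_univ v)
  rw [sum_degree_of_mem_bicyclicGraphs hG] at hsum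
  rw [Finset.card_erase_of_mem (Finset.mem_univ v), Finset.card_univ, smul_eq_mul] at hrest
  omega

theorem sumConnectivity_graphBThree_lt_of_two_le_degree (hG : G ∈ bicyclicGraphs V)
    (hcard : 8 ≤ Fintype.card V) (htwo : ∀ v, 2 ≤ G.degree v) :
    sumConnectivity (graphBThree (Fintype.card V)) < sumConnectivity G := by
  have hn : (8 : ℝ) ≤ Fintype.card V := by exact_mod_cast hcard
  have hzagreb := firstZagreb_add_le hG htwo (degree_le_four_of_two_le_degree hG htwo)
  have hbound := le_sumConnectivity_of_firstZagreb_le hG (a := 4)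
    (M := 4 * Fintype.card V + 12) (by norm_num) (by omega)
  push_cast at hbound
  rw [invSqrt_four] at hbound
  have hnext := invSqrt_le_invSqrt (k := 9) (l := Fintype.card V + 1) (by norm_num) (by omega)
  have hself := invSqrt_le_invSqrt (k := 4) (l := Fintype.card V) (by norm_num) (by omega)
  rw [invSqrt_nine] at hnext
  rw [invSqrt_four] at hself
  rw [sumConnectivity_graphBThree (by omega)]
  nlinarith

theorem sumConnectivity_graphB_three_le_of_isUniversal (hG : G ∈ bicyclicGraphs V)
    (hcard : 5 ≤ Fintype.card V) {c : V} (hc : G.IsUniversal c) :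
    sumConnectivity (graphB (Fintype.card V - 1) 3) ≤ sumConnectivity G := by
  rcases nonempty_iso_of_isUniversal hG hc with ⟨⟨e⟩⟩ | ⟨⟨e⟩⟩
  · exact (sumConnectivity_congr e).ge
  · exact sumConnectivity_congr e ▸ (sumConnectivity_graphB_three_lt_graphBThree hcard).le

theorem sumConnectivity_graphBThree_lt_of_attach_of_isUniversal (hG : G ∈ bicyclicGraphs V)
    (hcard : 8 ≤ Fintype.card V) {c w : V} (hc : G.IsUniversal c) (hwc : w ≠ c) :
    sumConnectivity (graphBThree (Fintype.card V + 1))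
      < sumConnectivity (attachPendents G fun _ : Unit => w) := by
  by_cases hdeg : G.degree w ≤ 2
  · calc sumConnectivity (graphBThree (Fintype.card V + 1))
        < sumConnectivity (graphB (Fintype.card V - 1) 3) + starGain 3 :=
          sumConnectivity_graphBThree_succ_lt_add_starGain_three hcard
      _ ≤ sumConnectivity G + starGain (G.degree w + 1) :=
          add_le_add (sumConnectivity_graphB_three_le_of_isUniversal hG (by omega) hc)
            (starGain_antitoneOn (by simp) (by simp) (by omega))
      _ ≤ _ := sumConnectivity_add_starGain_le G w
  · have hK := attachPendents_mem_bicyclicGraphs (fun _ : Unit => w) hG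
    have hdeg_c := attachPendents_degree_inl G (fun _ : Unit => w) c
    have hdeg_w := attachPendents_degree_inl G (fun _ : Unit => w) w
    simp only [(G.degree_eq_card_sub_one c).2 hc, hwc, Finset.filter_false, Finset.card_empty,
      add_zero] at hdeg_c
    simp only [Finset.filter_true, Finset.univ_unique, Finset.card_singleton] at hdeg_w
    have hcw : (Sum.inl c : V ⊕ Unit) ≠ Sum.inl w := by simpa using hwc.symm
    have hcardK : Fintype.card (V ⊕ Unit) = Fintype.card V + 1 := by simp
    have hle := degree_add_degree_le hK hcw
    rw [hcardK] at hle
    obtain ⟨e⟩ := nonempty_iso_graphB_of_degree_add_degree hK hcw (by omega)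
    rw [sumConnectivity_congr e, show (attachPendents G _).degree (Sum.inl w) = 4 by omega, hdeg_c]
    exact sumConnectivity_graphBThree_lt_graphB_four (n := Fintype.card V + 1) (by omega)

theorem sumConnectivity_graphBThree_lt {n : ℕ} (hn : 8 ≤ n) (hG : G ∈ bicyclicGraphs V)
    (hcard : Fintype.card V = n) (huniv : ∀ v, ¬ G.IsUniversal v) :
    sumConnectivity (graphBThree n) < sumConnectivity G := by
  induction n, hn using Nat.le_induction generalizing V with
  | base => exact sumConnectivity_graphBThree_lt_of_card_eq_eight hG hcard huniv
  | succ n hn ih =>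
    by_cases hpend : ∃ u, G.degree u = 1
    · obtain ⟨u, hu⟩ := hpend
      obtain ⟨W, _, H, w, hH, ⟨e⟩⟩ := exists_iso_attachPendents_of_degree_eq_one hG hu
      have hcardW : Fintype.card W = n := by
        have := Fintype.card_congr e.toEquiv
        simp only [Fintype.card_sum, Fintype.card_unit] at this
        omega
      have huniv_attach (x) : ¬ (attachPendents H fun _ : Unit => w).IsUniversal x :=
        fun hx => huniv _ (isUniversal_iso_apply e hx)
      rw [← sumConnectivity_congr e]
      by_cases hunivH : ∃ c, H.IsUniversal c
      · obtain ⟨c, hc⟩ := hunivH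
        have hwc : w ≠ c := by
          rintro rfl
          exact huniv_attach _ (attachPendents_isUniversal_inl hc)
        rw [← hcardW]
        exact sumConnectivity_graphBThree_lt_of_attach_of_isUniversal hH (by omega) hc hwc
      · have hdeg := degree_add_two_le_of_not_isUniversal (not_exists.1 hunivH w)
        calc sumConnectivity (graphBThree (n + 1))
            < sumConnectivity (graphBThree n) + starGain (n - 1) :=
              sumConnectivity_graphBThree_succ_lt (by omega)
          _ ≤ sumConnectivity H + starGain (H.degree w + 1) :=
              add_le_add (ih hH hcardW (not_exists.1 hunivH)).le
                (starGain_antitoneOn (by simp) (by simp; omega) (by omega))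
          _ ≤ _ := sumConnectivity_add_starGain_le H w
    · have htwo (v : V) : 2 ≤ G.degree v := by
        have := degree_pos_of_mem_bicyclicGraphs hG v
        have := not_exists.1 hpend v
        omega
      exact hcard ▸ sumConnectivity_graphBThree_lt_of_two_le_degree hG (by omega) htwo

end starGainInduction

section extremality

variable {V W₁ W₂ : Type*} [Fintype V] [Fintype W₁] [Fintype W₂]
  {B : SimpleGraph W₁} {C : SimpleGraph W₂}

theorem exists_iso_of_card_eq (hB : B ∈ bicyclicGraphs W₁)
    (hcard : Fintype.card W₁ = Fintype.card V) : ∃ G ∈ bicyclicGraphs V, Nonempty (G ≃g B) := by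
  let e := Iso.map (Fintype.equivOfCardEq hcard) B
  exact ⟨_, mem_bicyclicGraphs_congr e hB, ⟨e.symm⟩⟩

theorem isUniqueMinimum_of_iso_or_lt (hB : ∃ G ∈ bicyclicGraphs V, Nonempty (G ≃g B))
    (h : ∀ G ∈ bicyclicGraphs V, Nonempty (G ≃g B) ∨ sumConnectivity B < sumConnectivity G) :
    IsUniqueMinimum V B (sumConnectivity B) := by
  obtain ⟨H, hH, ⟨e⟩⟩ := hB
  refine ⟨⟨⟨H, hH, sumConnectivity_congr e⟩, ?_⟩, fun G hG => ⟨fun hval => ?_, ?_⟩⟩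
  · rintro _ ⟨G, hG, rfl⟩
    exact (h G hG).elim (fun ⟨e'⟩ => (sumConnectivity_congr e').ge) le_of_lt
  · exact (h G hG).resolve_right hval.not_gt
  · exact fun ⟨e'⟩ => sumConnectivity_congr e'

theorem isUniqueSecondMinimum_of_iso_or_iso_or_lt
    (hB : ∃ G ∈ bicyclicGraphs V, Nonempty (G ≃g B))
    (hC : ∃ G ∈ bicyclicGraphs V, Nonempty (G ≃g C)) (hBC : sumConnectivity B < sumConnectivity C)
    (h : ∀ G ∈ bicyclicGraphs V,
      Nonempty (G ≃g B) ∨ Nonempty (G ≃g C) ∨ sumConnectivity C < sumConnectivity G) :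
    IsUniqueSecondMinimum V C (sumConnectivity C) := by
  have hmin : ∀ G ∈ bicyclicGraphs V, sumConnectivity B ≤ sumConnectivity G := fun G hG => by
    rcases h G hG with ⟨⟨e⟩⟩ | ⟨⟨e⟩⟩ | hlt
    · exact (sumConnectivity_congr e).ge
    · exact sumConnectivity_congr e ▸ hBC.le
    · exact (hBC.trans hlt).le
  obtain ⟨H, hH, ⟨e⟩⟩ := hB
  obtain ⟨K, hK, ⟨e'⟩⟩ := hC
  refine ⟨⟨⟨⟨K, hK, sumConnectivity_congr e'⟩, _, ⟨H, hH, sumConnectivity_congr e⟩, hBC⟩, ?_⟩,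
    fun G hG => ⟨fun hval => ?_, fun ⟨e''⟩ => sumConnectivity_congr e''⟩⟩
  · rintro _ ⟨⟨G, hG, rfl⟩, _, ⟨L, hL, rfl⟩, hlt⟩
    rcases h G hG with ⟨⟨e''⟩⟩ | ⟨⟨e''⟩⟩ | hlt'
    · exact absurd (sumConnectivity_congr e'' ▸ hmin L hL) hlt.not_ge
    · exact (sumConnectivity_congr e'').ge
    · exact hlt'.le
  · rcases h G hG with ⟨⟨e''⟩⟩ | hiso | hlt
    · exact absurd (sumConnectivity_congr e'' ▸ hval) hBC.ne
    · exact hiso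
    · exact absurd hval hlt.ne'

end extremality

section classification

variable {V : Type*} [Fintype V] {G : SimpleGraph V}

theorem sumConnectivity_graphB_three_lt_graphFive :
    sumConnectivity (graphB 4 3) < sumConnectivity graphFive := by
  rw [sumConnectivity_graphB_three (n := 5) (by norm_num), sumConnectivity_graphFive]
  norm_num
  linarith [invSqrt_five_bounds.2, invSqrt_six_bounds.1, invSqrt_seven_bounds.2]

theorem sumConnectivity_graphFive_lt_graphBThree :
    sumConnectivity graphFive < sumConnectivity (graphBThree 5) := by
  rw [sumConnectivity_graphBThree le_rfl, sumConnectivity_graphFive]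
  norm_num
  linarith [invSqrt_five_bounds.2, invSqrt_six_bounds.1]

theorem sumConnectivity_graphB_three_lt_graphB_four {n : ℕ} (hn : n = 6 ∨ n = 7) :
    sumConnectivity (graphB (n - 1) 3) < sumConnectivity (graphB (n - 2) 4) := by
  rw [sumConnectivity_graphB_three (by omega), sumConnectivity_graphB_four (by omega)]
  rcases hn with rfl | rfl <;> norm_num <;>
    linarith [invSqrt_five_bounds.2, invSqrt_six_bounds.1, invSqrt_seven_bounds.2,
      invSqrt_eight_bounds.2]

theorem sumConnectivity_graphB_four_lt_graphBThree {n : ℕ} (hn : n = 6 ∨ n = 7) :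
    sumConnectivity (graphB (n - 2) 4) < sumConnectivity (graphBThree n) := by
  rw [sumConnectivity_graphB_four (by omega), sumConnectivity_graphBThree (by omega)]
  rcases hn with rfl | rfl <;> norm_num <;>
    linarith [invSqrt_five_bounds.2, invSqrt_six_bounds.1, invSqrt_six_bounds.2,
      invSqrt_seven_bounds.1, invSqrt_seven_bounds.2, invSqrt_eight_bounds.1,
      invSqrt_eight_bounds.2, invSqrt_nine]

theorem iso_graphB_three_or_iso_or_lt {W : Type*} [Fintype W] {C : SimpleGraph W}
    (hC : sumConnectivity C < sumConnectivity (graphBThree (Fintype.card V)))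
    (hG : G ∈ bicyclicGraphs V)
    (h : (∀ v, ¬ G.IsUniversal v) →
      Nonempty (G ≃g C) ∨ sumConnectivity C < sumConnectivity G) :
    Nonempty (G ≃g graphB (Fintype.card V - 1) 3) ∨ Nonempty (G ≃g C) ∨
      sumConnectivity C < sumConnectivity G := by
  by_cases huniv : ∃ c, G.IsUniversal c
  · obtain ⟨c, hc⟩ := huniv
    exact (nonempty_iso_of_isUniversal hG hc).imp_right fun ⟨e⟩ =>
      Or.inr (sumConnectivity_congr e ▸ hC)
  · exact Or.inr (h (not_exists.1 huniv))

theorem exists_iso_graphB {a b : ℕ} (ha : 3 ≤ a) (hb : 3 ≤ b)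
    (hcard : a + b = Fintype.card V + 2) : ∃ G ∈ bicyclicGraphs V, Nonempty (G ≃g graphB a b) := by
  refine exists_iso_of_card_eq (graphB_mem_bicyclicGraphs a b) ?_
  simp only [Fintype.card_sum, Fintype.card_fin]
  omega

theorem exists_iso_graphBThree (hcard : 5 ≤ Fintype.card V) :
    ∃ G ∈ bicyclicGraphs V, Nonempty (G ≃g graphBThree (Fintype.card V)) := by
  refine exists_iso_of_card_eq (graphBThree_mem_bicyclicGraphs _) ?_
  simp only [Fintype.card_sum, Fintype.card_fin]
  omega

theorem sumConnectivity_graphB_three_lt (hG : G ∈ bicyclicGraphs V) (hcard : 5 ≤ Fintype.card V)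
    (huniv : ∀ v, ¬ G.IsUniversal v) :
    sumConnectivity (graphB (Fintype.card V - 1) 3) < sumConnectivity G := by
  have hcases : Fintype.card V = 5 ∨ (Fintype.card V = 6 ∨ Fintype.card V = 7) ∨
      8 ≤ Fintype.card V := by omega
  rcases hcases with h | h | h
  · have hlt := sumConnectivity_graphB_three_lt_graphFive
    rw [h]
    exact (nonempty_iso_graphFive_or_sumConnectivity_lt hG h huniv).elim
      (fun ⟨e⟩ => sumConnectivity_congr e ▸ hlt) hlt.trans
  · have hlt := sumConnectivity_graphB_three_lt_graphB_four h
    exact (nonempty_iso_graphB_four_or_sumConnectivity_lt hG h huniv).elim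
      (fun ⟨e⟩ => sumConnectivity_congr e ▸ hlt) hlt.trans
  · exact (sumConnectivity_graphB_three_lt_graphBThree hcard).trans
      (sumConnectivity_graphBThree_lt h hG rfl huniv)

theorem isUniqueMinimum_graphB_three (hcard : 5 ≤ Fintype.card V) :
    IsUniqueMinimum V (graphB (Fintype.card V - 1) 3)
      (sumConnectivity (graphB (Fintype.card V - 1) 3)) := by
  refine isUniqueMinimum_of_iso_or_lt (exists_iso_graphB (by omega) le_rfl (by omega))
    fun G hG => ?_
  by_cases huniv : ∃ c, G.IsUniversal c
  · obtain ⟨c, hc⟩ := huniv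
    exact (nonempty_iso_of_isUniversal hG hc).imp_right fun ⟨e⟩ =>
      sumConnectivity_congr e ▸ sumConnectivity_graphB_three_lt_graphBThree hcard
  · exact Or.inr (sumConnectivity_graphB_three_lt hG hcard (not_exists.1 huniv))

theorem isUniqueSecondMinimum_graphFive (hcard : Fintype.card V = 5) :
    IsUniqueSecondMinimum V graphFive (sumConnectivity graphFive) := by
  refine isUniqueSecondMinimum_of_iso_or_iso_or_lt
    (exists_iso_graphB (a := 4) (by norm_num) le_rfl (by omega))
    (exists_iso_of_card_eq graphFive_mem_bicyclicGraphs (by simp [hcard]))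
    sumConnectivity_graphB_three_lt_graphFive fun G hG => ?_
  have h := iso_graphB_three_or_iso_or_lt (C := graphFive)
    (by rw [hcard]; exact sumConnectivity_graphFive_lt_graphBThree) hG
    (nonempty_iso_graphFive_or_sumConnectivity_lt hG hcard)
  rwa [hcard] at h

theorem isUniqueSecondMinimum_graphB_four (hcard : Fintype.card V = 6 ∨ Fintype.card V = 7) :
    IsUniqueSecondMinimum V (graphB (Fintype.card V - 2) 4)
      (sumConnectivity (graphB (Fintype.card V - 2) 4)) :=
  isUniqueSecondMinimum_of_iso_or_iso_or_lt
    (exists_iso_graphB (a := Fintype.card V - 1) (by omega) le_rfl (by omega))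
    (exists_iso_graphB (by omega) (by norm_num) (by omega))
    (sumConnectivity_graphB_three_lt_graphB_four hcard) fun _ hG =>
      iso_graphB_three_or_iso_or_lt (sumConnectivity_graphB_four_lt_graphBThree hcard) hG
        (nonempty_iso_graphB_four_or_sumConnectivity_lt hG hcard)

theorem isUniqueSecondMinimum_graphBThree (hcard : 8 ≤ Fintype.card V) :
    IsUniqueSecondMinimum V (graphBThree (Fintype.card V))
      (sumConnectivity (graphBThree (Fintype.card V))) := by
  refine isUniqueSecondMinimum_of_iso_or_iso_or_lt
    (exists_iso_graphB (a := Fintype.card V - 1) (by omega) le_rfl (by omega))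
    (exists_iso_graphBThree (by omega))
    (sumConnectivity_graphB_three_lt_graphBThree (by omega)) fun G hG => ?_
  by_cases huniv : ∃ c, G.IsUniversal c
  · obtain ⟨c, hc⟩ := huniv
    exact (nonempty_iso_of_isUniversal hG hc).imp_right Or.inl
  · exact Or.inr (Or.inr (sumConnectivity_graphBThree_lt hcard hG rfl (not_exists.1 huniv)))

end classification

section closedForm

theorem sumConnectivity_graphB_three_eq_sqrt {n : ℕ} (hn : 4 ≤ n) :
    sumConnectivity (graphB (n - 1) 3) =
      1 / √((n : ℝ) + 2) + ((n : ℝ) - 4) / √(n : ℝ) + 2 / √((n : ℝ) + 1) + 2 / √5 := by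
  rw [sumConnectivity_graphB_three hn]
  simp [invSqrt, div_eq_mul_inv]

theorem sumConnectivity_graphFive_eq_sqrt :
    sumConnectivity graphFive = 3 / √6 + 2 / √5 + 1 / 2 := by
  rw [sumConnectivity_graphFive]
  simp [invSqrt, div_eq_mul_inv]

theorem sumConnectivity_graphB_four_eq_sqrt {n : ℕ} (hn : 5 ≤ n) :
    sumConnectivity (graphB (n - 2) 4) =
      1 / √((n : ℝ) + 2) + 2 / √(n : ℝ) + ((n : ℝ) - 5) / √((n : ℝ) - 1) + 2 / √6 + 1 / √5 := by
  rw [sumConnectivity_graphB_four hn]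
  simp [invSqrt, div_eq_mul_inv, Nat.cast_sub (show 1 ≤ n by omega)]

theorem sumConnectivity_graphBThree_eq_sqrt {n : ℕ} (hn : 5 ≤ n) :
    sumConnectivity (graphBThree n) =
      4 / √((n : ℝ) + 1) + ((n : ℝ) - 5) / √(n : ℝ) + 1 := by
  rw [sumConnectivity_graphBThree hn]
  simp [invSqrt, div_eq_mul_inv]

end closedForm

end SumConn

end

theorem mainTheorem4 {V : Type*} [Fintype V] (n : ℕ) (hn : 5 ≤ n) (hV : Fintype.card V = n) :
    SumConn.IsUniqueMinimum V (SumConn.graphB (n - 1) 3)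
      (1 / √((n : ℝ) + 2) + ((n : ℝ) - 4) / √(n : ℝ) + 2 / √((n : ℝ) + 1) + 2 / √5) ∧
    (n = 5 →
      SumConn.IsUniqueSecondMinimum V SumConn.graphFive (3 / √6 + 2 / √5 + 1 / 2)) ∧
    (n = 6 ∨ n = 7 →
      SumConn.IsUniqueSecondMinimum V (SumConn.graphB (n - 2) 4)
        (1 / √((n : ℝ) + 2) + 2 / √(n : ℝ) + ((n : ℝ) - 5) / √((n : ℝ) - 1)
          + 2 / √6 + 1 / √5)) ∧
    (8 ≤ n →
      SumConn.IsUniqueSecondMinimum V (SumConn.graphBThree n)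
        (4 / √((n : ℝ) + 1) + ((n : ℝ) - 5) / √(n : ℝ) + 1)) := by
  subst hV
  rw [← SumConn.sumConnectivity_graphB_three_eq_sqrt (by omega),
    ← SumConn.sumConnectivity_graphFive_eq_sqrt,
    ← SumConn.sumConnectivity_graphB_four_eq_sqrt hn,
    ← SumConn.sumConnectivity_graphBThree_eq_sqrt hn]
  exact ⟨SumConn.isUniqueMinimum_graphB_three hn, SumConn.isUniqueSecondMinimum_graphFive,
    SumConn.isUniqueSecondMinimum_graphB_four, SumConn.isUniqueSecondMinimum_graphBThree⟩
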